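/- Let $K$ be an algebraically closed field. For an algebra $A=KQ/I$ given by a quiver with relations (paths are composed from left to right, and $P_v=e_vA$ is the indecomposable projective right module at the vertex $v$), the Cartan matrix $C_A$ is the matrix indexed by the vertices of $Q$ with $(C_A)_{ij}=\dim_K\operatorname{Hom}_A(P_j,P_i)$. Let $D_n$ ($n\ge 4$) be the quiver with arrows $1\to 3$, $2\to 3$, $3\to 4\to\dots\to n$. For a quiver $Q$ that can be reached from $D_n$ by a finite sequence of Fomin–Zelevinsky mutations (up to isomorphism), the corresponding cluster-tilted algebra of type $D_n$ has the quiver $Q$, and for the quivers below it is given by the relations stated there. For $s,t\ge 0$ let $A(s,t)$ be the quiver consisting of a linear quiver $v_0\to v_1\to\dots\to v_{s+t}$ and of vertices $w_1,\dots,w_t$ with arrows $v_{s+p}\to w_p\to v_{s+p-1}$ for $1\le p\le t$, where the product of any two consecutive arrows of a triangle $v_{s+p-1}\to v_{s+p}\to w_p\to v_{s+p-1}$ is zero; its root is $v_0$. To glue $A(s,t)$ to a quiver with relations at a vertex $c$ means to identify its root with $c$ and to take the union of the arrows and of the relations. Given a non-empty sequence of triples $\bigl((d_1,s_1,t_1),\dots,(d_r,s_r,t_r)\bigr)$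 with $d_j\ge1$, $s_j,t_j\ge0$ and $\ell=d_1+\dots+d_r\ge 3$, the quiver with relations of type IV with this parameter sequence is the following. There is an oriented central cycle $0\to1\to\dots\to \ell-1\to0$ (vertices modulo $\ell$). For each $j$, with $i_j=d_1+\dots+d_{j-1}$, there is a vertex $c_j$ with arrows $i_j+1\to c_j\to i_j$. The paths $i_j\to i_j+1\to c_j$ and $c_j\to i_j\to i_j+1$ are zero, and the path $i_j+1\to c_j\to i_j$ equals the path of length $\ell-1$ from $i_j+1$ to $i_j$ along the central cycle. For $i\notin\{i_1,\dots,i_r\}$ the path of length $\ell-1$ from $i+1$ to $i$ along the central cycle is zero. Finally, $A(s_j,t_j)$ is glued at $c_j$ for each $j$. The standard forms of cluster-tilted algebras of type $D$ are the algebras of the following quivers with relations: (a) $D_n$, $n\ge4$, without relations; (b) for $s,t\ge0$: the quiver with arrows $c'\to b\to c''$, $c'\to a\to c''$, $c''\to c'$, in which the two paths from $c'$ to $c''$ of length two are equal and the paths $c''\to c'\to b$, $c''\to c'\to a$, $b\to c''\to c'$, $a\to c''\to c'$ are zero, with $A(s,t)$ glued at $c'$; (c) for $s,t\ge0$: the oriented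 cycle $c'\to b\to c''\to a\to c'$, in which all paths of length three are zero, with $A(s,t)$ glued at $c'$; (d1) an oriented cycle of odd length $n\ge 5$, in which all paths of length $n-1$ are zero; (d2) type IV with parameter sequence $\bigl((1,s,t),(1,0,0),\dots,(1,0,0)\bigr)$ of length at least $3$, with $s,t\ge0$; (d3) type IV with parameter sequence $\bigl((1,0,0),\dots,(1,0,0),(3,s_1,t_1),\dots,(3,s_k,t_k)\bigr)$, where $k\ge1$, the number of triples $(1,0,0)$ is any $b\ge0$, $s_j,t_j\ge0$, and the sequence $\bigl((s_1,t_1),\dots,(s_k,t_k)\bigr)$ is considered up to rotation. Two standard forms are distinct if they belong to different classes or have different parameters, where in (d3) the sequence of pairs $(s_j,t_j)$ is taken up to rotation. **Corollary 2.12.** Let $m\ge1$ and $n=6m+13$. Then there are $m+1$ pairwise distinct standard forms of cluster-tilted algebras of type $D_n$ (that is, their quivers are mutation equivalent to $D_n$, and the algebras are finite-dimensional) whose Cartan matrices define pairwise equivalent bilinear forms over $\mathbb Z$: for any two of them, with Cartan matrices $C$ and $C'$, there is $P\in\operatorname{GL}_n(\mathbb Z)$ with $PCP^{T}=C'$. 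-/

import Mathlib

open Matrix

/-! ### Quivers with relations -/

/-- A finite quiver without multiple arrows, together with zero relations and commutativity
relations.  As there is at most one arrow from one vertex to another, a path is given by
the list of the vertices it visits, in the order in which it visits them.  The paths in `zero` are
set to zero, and for each pair in `comm` its two (parallel) paths are set equal. -/
structure BoundQuiver where
  V : Type
  [fintype : Fintype V]
  [decEq : DecidableEq V]
  Arrow : V → V → Prop
  zero : Set (List V)
  comm : Set (List V × List V)

attribute [instance] BoundQuiver.fintype BoundQuiver.decEq

namespace BoundQuiver

/-! ### The algebra of a quiver with relations and its Cartan matrix -/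

section Algebra

variable (K : Type*) [Field K] (Q : BoundQuiver)

/-- The free algebra on a symbol for every vertex and a symbol for every ordered pair of
vertices; the latter symbol stands for the arrow if there is one, and is set to zero below
otherwise. -/
abbrev Free : Type _ := FreeAlgebra K (Q.V ⊕ Q.V × Q.V)

/-- The symbol of the trivial path at `v`. -/
def vert (v : Q.V) : Q.Free K := FreeAlgebra.ι K (Sum.inl v)

/-- The symbol of the arrow from `u` to `v`. -/
def arr (u v : Q.V) : Q.Free K := FreeAlgebra.ι K (Sum.inr (u, v))

/-- The product of the arrows along a path, composed from left to right. -/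
def word : List Q.V → Q.Free K
  | [] => 1
  | [v] => Q.vert K v
  | u :: v :: l => Q.arr K u v * word (v :: l)

/-- Defining relations of `K Q / I`: those of the path algebra `K Q`, followed by the generators
of the ideal `I`. -/
inductive Rel : Q.Free K → Q.Free K → Prop
  | vert_idem (v : Q.V) : Rel (Q.vert K v * Q.vert K v) (Q.vert K v)
  | vert_orth (u v : Q.V) (h : u ≠ v) : Rel (Q.vert K u * Q.vert K v) 0
  | vert_sum : Rel (∑ v : Q.V, Q.vert K v) 1
  | source (u v : Q.V) : Rel (Q.vert K u * Q.arr K u v) (Q.arr K u v)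
  | target (u v : Q.V) : Rel (Q.arr K u v * Q.vert K v) (Q.arr K u v)
  | no_arrow (u v : Q.V) (h : ¬ Q.Arrow u v) : Rel (Q.arr K u v) 0
  | zero_path (p : List Q.V) (h : p ∈ Q.zero) : Rel (Q.word K p) 0
  | comm_paths (p q : List Q.V) (h : (p, q) ∈ Q.comm) : Rel (Q.word K p) (Q.word K q)

/-- The algebra `K Q / I`. -/
abbrev Alg : Type _ := RingQuot (Q.Rel K)

/-- The idempotent `e_v` of `K Q / I`. -/
def idem (v : Q.V) : Q.Alg K := RingQuot.mkAlgHom K (Q.Rel K) (Q.vert K v)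

/-- The indecomposable projective right module `P_v = e_v A` of `A = K Q / I`, spanned by the
paths starting at `v`. -/
abbrev proj (v : Q.V) : Submodule (Q.Alg K)ᵐᵒᵖ (Q.Alg K) :=
  Submodule.span (Q.Alg K)ᵐᵒᵖ {Q.idem K v}

/-- The Cartan matrix, with entries `dim Hom(P_j, P_i)`. -/
noncomputable def cartan : Matrix Q.V Q.V ℤ :=
  Matrix.of fun i j => (Module.finrank K (Q.proj K j →ₗ[(Q.Alg K)ᵐᵒᵖ] Q.proj K i) : ℤ)

end Algebra

/-! ### Gluing rooted quivers to a skeleton -/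

section Glue

variable (S : BoundQuiver) {r : ℕ} (c : Fin r → S.V) (R : Fin r → BoundQuiver)
  (v : (j : Fin r) → (R j).V)

/-- The vertices of the gluing: those of the skeleton, and those of the glued quivers except for
their roots. -/
abbrev GlueV : Type := S.V ⊕ (Σ j : Fin r, {x : (R j).V // x ≠ v j})

/-- The map from the `j`-th glued quiver to the gluing; it sends the root `v j` to `c j`. -/
def glueMap (j : Fin r) (x : (R j).V) : GlueV S R v :=
  if h : x = v j then Sum.inl (c j) else Sum.inr ⟨j, x, h⟩

/-- The gluing of the rooted quivers `(R j, v j)` to the skeleton `S` at the vertices `c j`, with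
the union of all relations. -/
def glue : BoundQuiver where
  V := GlueV S R v
  Arrow x y := (∃ a b, S.Arrow a b ∧ x = Sum.inl a ∧ y = Sum.inl b) ∨
    ∃ j a b, (R j).Arrow a b ∧ x = glueMap S c R v j a ∧ y = glueMap S c R v j b
  zero := {p | (∃ q ∈ S.zero, p = q.map Sum.inl) ∨
    ∃ j, ∃ q ∈ (R j).zero, p = q.map (glueMap S c R v j)}
  comm := {p | (∃ q ∈ S.comm, p = (q.1.map Sum.inl, q.2.map Sum.inl)) ∨
    ∃ j, ∃ q ∈ (R j).comm, p = (q.1.map (glueMap S c R v j), q.2.map (glueMap S c R v j))}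

end Glue

/-- The standard form of a rooted quiver of type `A` with `s` lines and `t` triangles.  The vertices
`Sum.inl 0 → Sum.inl 1 → ... → Sum.inl (s + t)` form a linear quiver whose first `s` arrows are the
lines; its last `t` arrows are each completed to an oriented triangle
`inl (s + p) → inl (s + p + 1) → inr p → inl (s + p)`, in which the product of any two consecutive
arrows is zero.  The root is `Sum.inl 0`. -/
def typeA (s t : ℕ) : BoundQuiver where
  V := Fin (s + t + 1) ⊕ Fin t
  Arrow x y := match x, y with
    | Sum.inl a, Sum.inl b => (b : ℕ) = a + 1
    | Sum.inl a, Sum.inr p => (a : ℕ) = s + p + 1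
    | Sum.inr p, Sum.inl a => (a : ℕ) = s + p
    | Sum.inr _, Sum.inr _ => False
  zero := {l | ∃ (p : Fin t) (x y : Fin (s + t + 1)), (x : ℕ) = s + p ∧ (y : ℕ) = s + p + 1 ∧
    (l = [Sum.inl x, Sum.inl y, Sum.inr p] ∨ l = [Sum.inl y, Sum.inr p, Sum.inl x] ∨
      l = [Sum.inr p, Sum.inl x, Sum.inl y])}
  comm := ∅

/-- The root of `typeA s t`. -/
def rootA (s t : ℕ) : (typeA s t).V := Sum.inl (0 : Fin (s + t + 1))

/-! ### The skeleta -/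

/-- Two vertices `0, 1` with an arrow to the vertex `2`, where a quiver of type `A` is glued. -/
def skeletonI : BoundQuiver where
  V := Fin 3
  Arrow x y := (x, y) ∈ ({(0, 2), (1, 2)} : Set (Fin 3 × Fin 3))
  zero := ∅
  comm := ∅

/-- The vertices are `a = 0`, `b = 1`, `c' = 2`, `c'' = 3`; the arrows are `c' → b → c''`,
`c' → a → c''` and `c'' → c'`. -/
def skeletonII : BoundQuiver where
  V := Fin 4
  Arrow x y := (x, y) ∈ ({(2, 1), (1, 3), (2, 0), (0, 3), (3, 2)} : Set (Fin 4 × Fin 4))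
  zero := {[3, 2, 1], [3, 2, 0], [1, 3, 2], [0, 3, 2]}
  comm := {([2, 1, 3], [2, 0, 3])}

/-- The oriented 4-cycle `c' → b → c'' → a → c'` on the vertices `a = 0`, `b = 1`, `c' = 2`,
`c'' = 3`, in which all paths of length three are zero. -/
def skeletonIII : BoundQuiver where
  V := Fin 4
  Arrow x y := (x, y) ∈ ({(2, 1), (1, 3), (3, 0), (0, 2)} : Set (Fin 4 × Fin 4))
  zero := {[2, 1, 3, 0], [1, 3, 0, 2], [3, 0, 2, 1], [0, 2, 1, 3]}
  comm := ∅

/-- The vertices, in order, of the path `x + 1, x + 2, ..., x` of length `m - 1` along an oriented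
cycle with vertices `0, ..., m - 1`. -/
def centralPath {m : ℕ} (x : Fin m) : List (Fin m) :=
  List.ofFn fun k : Fin m => ⟨(x + 1 + k) % m, Nat.mod_lt _ x.pos⟩

/-- An oriented central cycle `0 → 1 → ... → m - 1 → 0` with `m ≥ 3` vertices, and for each `j` a
spike, that is an oriented triangle `i j → i j + 1 → c_j → i j` on an arrow of the central cycle;
here `c_j = Sum.inr j`, and the `i j` are distinct.  In each spike the paths `i j → i j + 1 → c_j`
and `c_j → i j → i j + 1` are zero and the path `i j + 1 → c_j → i j` equals the path of length
`m - 1` along the central cycle from `i j + 1` to `i j`.  For an arrow `x → x + 1` of the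
central cycle that is not in a spike the path of length `m - 1` along the central cycle from
`x + 1` to `x` is zero. -/
def skeletonIV (m r : ℕ) (i : Fin r → ℕ) : BoundQuiver where
  V := Fin m ⊕ Fin r
  Arrow x y := match x, y with
    | Sum.inl a, Sum.inl b => (b : ℕ) = (a + 1) % m
    | Sum.inl a, Sum.inr j => (a : ℕ) = (i j + 1) % m
    | Sum.inr j, Sum.inl a => (a : ℕ) = i j
    | Sum.inr _, Sum.inr _ => False
  zero := {l | (∃ (j : Fin r) (x y : Fin m), (x : ℕ) = i j ∧ (y : ℕ) = (i j + 1) % m ∧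
      (l = [Sum.inl x, Sum.inl y, Sum.inr j] ∨ l = [Sum.inr j, Sum.inl x, Sum.inl y])) ∨
    ∃ x : Fin m, (∀ j, (x : ℕ) ≠ i j) ∧ l = (centralPath x).map Sum.inl}
  comm := {l | ∃ (j : Fin r) (x y : Fin m), (x : ℕ) = i j ∧ (y : ℕ) = (i j + 1) % m ∧
    l = ([Sum.inl y, Sum.inr j, Sum.inl x], (centralPath x).map Sum.inl)}

/-- The quiver with relations of type IV with (non-empty) parameter sequence
`(d_1, s_1, t_1), ..., (d_r, s_r, t_r)`, all `d_j ≥ 1`: the central cycle has `d_1 + ... + d_r`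
vertices, the `j`-th spike is at `i_j = d_1 + ... + d_{j-1}`, and the rooted quiver of type `A` in
standard form with `s_j` lines and `t_j` triangles is glued to the vertex `c_j` of this spike. -/
def typeIV (L : List (ℕ × ℕ × ℕ)) : BoundQuiver :=
  glue (skeletonIV (L.map fun x => x.1).sum L.length fun j => ((L.take j).map fun x => x.1).sum)
    (fun j => Sum.inr j) (fun j => typeA (L.get j).2.1 (L.get j).2.2)
    (fun j => rootA (L.get j).2.1 (L.get j).2.2)

end BoundQuiver

/-! ### Standard forms -/

open BoundQuiver in
/-- The parameters of the standard forms for derived equivalence of the cluster-tilted algebras of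
type `D`. -/
inductive StandardForm : Type
  /-- The quiver `D_n` with `n = s + 3`. -/
  | a (s : ℕ) (hs : 1 ≤ s)
  /-- Type II with one quiver of type `A` attached. -/
  | b (s t : ℕ)
  /-- Type III with one quiver of type `A` attached. -/
  | c (s t : ℕ)
  /-- Type IV without spikes: an oriented cycle of odd length `n`. -/
  | d₁ (n : ℕ) (hn : 4 ≤ n) (hodd : Odd n)
  /-- Type IV with the `k` parameters `(1, s, t), (1, 0, 0), ..., (1, 0, 0)`. -/
  | d₂ (k s t : ℕ) (hk : 3 ≤ k)
  /-- Type IV with `k` parameters `(1, 0, 0)` followed by the parameters `(3, s, t)` for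
  `(s, t)` in the non-empty list `p`. -/
  | d₃ (k : ℕ) (p : List (ℕ × ℕ)) (hp : p ≠ [])

namespace StandardForm

/-- The quiver with relations of a standard form. -/
def quiver : StandardForm → BoundQuiver
  | a s _ => BoundQuiver.glue BoundQuiver.skeletonI (fun _ : Fin 1 => (2 : Fin 3))
      (fun _ => BoundQuiver.typeA s 0) (fun _ => BoundQuiver.rootA s 0)
  | b s t => BoundQuiver.glue BoundQuiver.skeletonII (fun _ : Fin 1 => (2 : Fin 4))
      (fun _ => BoundQuiver.typeA s t) (fun _ => BoundQuiver.rootA s t)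
  | c s t => BoundQuiver.glue BoundQuiver.skeletonIII (fun _ : Fin 1 => (2 : Fin 4))
      (fun _ => BoundQuiver.typeA s t) (fun _ => BoundQuiver.rootA s t)
  | d₁ n _ _ => BoundQuiver.skeletonIV n 0 Fin.elim0
  | d₂ k s t _ => BoundQuiver.typeIV ((1, s, t) :: List.replicate (k - 1) (1, 0, 0))
  | d₃ k p _ => BoundQuiver.typeIV
      (List.replicate k (1, 0, 0) ++ p.map fun x => (3, x.1, x.2))

/-- Two standard forms coincide if their parameters do, where for `d₃` the sequence of the
pairs `(s, t)` is taken up to rotation. -/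
def Same : StandardForm → StandardForm → Prop
  | d₃ k p _, d₃ l q _ => k = l ∧ p.IsRotated q
  | F, G => F = G

end StandardForm

/-! ### Mutation class of `D_n` -/

/-- Fomin–Zelevinsky mutation at `k` of the skew-symmetric matrix `B` of a quiver without loops
and oriented 2-cycles, where `B i j` is the number of arrows from `i` to `j` minus the number of
arrows from `j` to `i`. -/
def mutate {V : Type*} [DecidableEq V] (k : V) (B : Matrix V V ℤ) : Matrix V V ℤ :=
  Matrix.of fun i j => if i = k ∨ j = k then -B i j else
    B i j + max (B i k) 0 * max (B k j) 0 - max (B j k) 0 * max (B k i) 0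

open Classical in
/-- The skew-symmetric matrix of a quiver without multiple arrows. -/
noncomputable def exchangeMatrix {V : Type*} (Arrow : V → V → Prop) : Matrix V V ℤ :=
  Matrix.of fun i j => (if Arrow i j then 1 else 0) - (if Arrow j i then 1 else 0)

/-- The arrows of the quiver `D_n`: `1 → 3`, `2 → 3`, `3 → 4 → ... → n`, with the vertices numbered
from `0` instead of `1`. -/
def dynkinDArrow (n : ℕ) (i j : Fin n) : Prop :=
  ((i : ℕ) ≤ 1 ∧ (j : ℕ) = 2) ∨ (2 ≤ (i : ℕ) ∧ (j : ℕ) = i + 1)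

/-- The quiver of `Q` has no loops and no oriented 2-cycles, and is, up to a numbering of its
vertices by `0, ..., n - 1`, related to the quiver `D_n` by a finite sequence of mutations. -/
def BoundQuiver.IsMutationEquivalentToD (Q : BoundQuiver) (n : ℕ) : Prop :=
  (∀ u v : Q.V, Q.Arrow u v → ¬ Q.Arrow v u) ∧
    ∃ e : Q.V ≃ Fin n,
      Relation.ReflTransGen (fun B B' : Matrix (Fin n) (Fin n) ℤ => ∃ k, B' = mutate k B)
        (Matrix.reindex e e (exchangeMatrix Q.Arrow)) (exchangeMatrix (dynkinDArrow n))

/-! ### Integral equivalence of bilinear forms -/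

/-- The bilinear forms over `ℤ` defined by `C` and `C'` are equivalent: `P C Pᵀ = C'` for some
`P ∈ GL_n(ℤ)`, after matching the index sets by a bijection (which only depends on how the
indices are numbered). -/
def IntEquivalentForms {V W : Type*} [Fintype V] [DecidableEq V]
    (C : Matrix V V ℤ) (C' : Matrix W W ℤ) : Prop :=
  ∃ (e : W ≃ V) (P : GL V ℤ),
    (P : Matrix V V ℤ) * C * (P : Matrix V V ℤ)ᵀ = Matrix.reindex e e C'

/-! The family consists of the forms `d₃ 0 [(2i, 2m+1-2i), (2m+1-2i, 2i+1)]` for `0 ≤ i ≤ m`: a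
central hexagon with spikes on two opposite arrows and a type `A` tail on each spike. Both `t j` are
odd, and the sums `s j + t j` (namely `2m+1` and `2m+2`) and `t 0 + t 1 = 2m+2` do not depend on
`i`. The number of vertices is `8 + Σ (s j + t j) + Σ t j = 6m + 13`. The forms are distinct by
parity, since `2i` is never equal to `2m+1-2j`.

The Cartan matrix is computed from a `PeirceBasis`. Each `e_i A e_j` has dimension at most one. The
multiplication rules `bas_mul_arr` show that the chosen paths span. A representation with
one-dimensional spaces (`isRep_step`) shows that they do not vanish. Hence the Cartan matrix is the
0/1 matrix of the relation `Reach` (`cartan_equiv`).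

The equivalence of forms comes from a change of basis that trades triangles for skew planes. Put `u
= s + t` and `t = 2r + 1` for one tail. Take vectors `h_0, ..., h_u` with `⟨h_p, h_q⟩ = 1` for `p ≤
q` and `0` otherwise, one further vector `e`, and `r` planes with basis `f_i, g_i` and `⟨f_i, g_i⟩ =
2 = -⟨g_i, f_i⟩`, orthogonal to everything else. The vertices of the tail become `v_q = h_q` for `q
≤ s`, `v_q = h_q - (f_0 + ... + f_{k-1})` for `q = s + 2k`, `v_q = h_u - h_q + e + g_k` for `q = s +
2k + 1` (with `g_r = 0`), and `w_p = (-1)^p (h_{s+p} - h_{s+p+1})`. They have the Cartan products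
(`form_vec_vec`) and generate the lattice (`single_mem_span`). In the new basis `s` and `t` are
visible only through `u` and the number of planes. As the planes are orthogonal to the rest, those
of the two tails can be pooled, and only `u 0`, `u 1` and `r 0 + r 1` matter
(`intEquivalentForms_gram`, `intEquivalentForms_cartan`).

For the mutation class, mutation at the apex of each triangle turns the tails into linear branches
(`mut_exchangeMatrix`). An explicit sequence then collapses the hexagon, carries a fork to the end
of one branch and straightens what is left to `D_n` (`Mut.hexagon`). -/

namespace BoundQuiver

/-! ### Algebras with one-dimensional Peirce components and their Cartan matrices -/

section PeirceBasis

variable (K : Type*) [Field K] (Q : BoundQuiver)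

/-- The arrow from `u` to `v` in `K Q / I`. -/
def arrow (u v : Q.V) : Q.Alg K := RingQuot.mkAlgHom K (Q.Rel K) (Q.arr K u v)

/-- The class of a path in `K Q / I`. -/
def path (p : List Q.V) : Q.Alg K := RingQuot.mkAlgHom K (Q.Rel K) (Q.word K p)

lemma mk_eq {x y : Q.Free K} (h : Q.Rel K x y) :
    RingQuot.mkAlgHom K (Q.Rel K) x = RingQuot.mkAlgHom K (Q.Rel K) y :=
  RingQuot.mkAlgHom_rel K h

@[simp] lemma idem_mul_self (v : Q.V) : Q.idem K v * Q.idem K v = Q.idem K v := by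
  rw [idem, ← map_mul]; exact Q.mk_eq K (.vert_idem v)

lemma idem_mul_of_ne {u v : Q.V} (h : u ≠ v) : Q.idem K u * Q.idem K v = 0 := by
  rw [idem, idem, ← map_mul, Q.mk_eq K (.vert_orth u v h), map_zero]

lemma sum_idem : ∑ v : Q.V, Q.idem K v = 1 := by
  simp only [idem]
  rw [← map_sum, Q.mk_eq K .vert_sum, map_one]

@[simp] lemma idem_mul_arrow (u v : Q.V) : Q.idem K u * Q.arrow K u v = Q.arrow K u v := by
  rw [idem, arrow, ← map_mul]; exact Q.mk_eq K (.source u v)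

@[simp] lemma arrow_mul_idem (u v : Q.V) : Q.arrow K u v * Q.idem K v = Q.arrow K u v := by
  rw [idem, arrow, ← map_mul]; exact Q.mk_eq K (.target u v)

lemma arrow_eq_zero {u v : Q.V} (h : ¬ Q.Arrow u v) : Q.arrow K u v = 0 := by
  rw [arrow, Q.mk_eq K (.no_arrow u v h), map_zero]

lemma path_eq_zero {p : List Q.V} (h : p ∈ Q.zero) : Q.path K p = 0 := by
  rw [path, Q.mk_eq K (.zero_path p h), map_zero]

lemma path_eq_path {p q : List Q.V} (h : (p, q) ∈ Q.comm) : Q.path K p = Q.path K q :=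
  Q.mk_eq K (.comm_paths p q h)

@[simp] lemma path_singleton (v : Q.V) : Q.path K [v] = Q.idem K v := rfl

@[simp] lemma path_cons_cons (u v : Q.V) (l : List Q.V) :
    Q.path K (u :: v :: l) = Q.arrow K u v * Q.path K (v :: l) := by
  simp [path, word, arrow]

section Representation

open Classical in
/-- Action of the generators of the free algebra on the representation with one-dimensional spaces
at all vertices, in which the arrows in `α` act as the identity and the other ones as zero. -/
noncomputable def repFree (α : Q.V → Q.V → Prop) : Q.Free K →ₐ[K] Matrix Q.V Q.V K :=
  FreeAlgebra.lift K (Sum.elim (fun v => Matrix.single v v 1)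
    (fun e => if α e.1 e.2 then Matrix.single e.1 e.2 1 else 0))

variable {Q} (α : Q.V → Q.V → Prop)

lemma repFree_vert (v : Q.V) : Q.repFree K α (Q.vert K v) = Matrix.single v v 1 := by
  simp [repFree, vert]

open Classical in
lemma repFree_arr (u v : Q.V) :
    Q.repFree K α (Q.arr K u v) = if α u v then Matrix.single u v 1 else 0 := by
  simp [repFree, arr]

-- Consecutive matrix units multiply to the unit from the first vertex to the last, and one arrow
-- outside `α` kills the product. Relations can therefore be checked on lists of vertices.
open Classical in
lemma repFree_word (u : Q.V) (l : List Q.V) : Q.repFree K α (Q.word K (u :: l)) =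
    if (u :: l).IsChain α then Matrix.single u ((u :: l).getLast (by simp)) 1 else 0 := by
  induction l generalizing u with
  | nil => simp [word, repFree_vert]
  | cons v l ih =>
    rw [word, map_mul, ih, repFree_arr]
    by_cases h : α u v <;> by_cases h' : (v :: l).IsChain α <;> simp [h, h', List.isChain_cons_cons]

/-- The conditions under which `Matrix.single`s at the arrows in `α` satisfy the relations. -/
structure IsRep (α : Q.V → Q.V → Prop) : Prop where
  arrow : ∀ u v, α u v → Q.Arrow u v
  zero : ∀ p ∈ Q.zero, ¬ p.IsChain α
  head : ∀ p ∈ Q.comm, p.1.head? = p.2.head?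
  last : ∀ p ∈ Q.comm, p.1.getLast? = p.2.getLast?
  ne_nil : ∀ p ∈ Q.comm, p.1 ≠ []
  comm : ∀ p ∈ Q.comm, p.1.IsChain α ↔ p.2.IsChain α

variable {α}

lemma IsRep.repFree_rel (h : IsRep α) {x y : Q.Free K} (hxy : Q.Rel K x y) :
    Q.repFree K α x = Q.repFree K α y := by
  classical
  cases hxy with
  | vert_idem v => simp [repFree_vert]
  | vert_orth u v huv => simp [repFree_vert, huv]
  | vert_sum =>
    rw [map_sum, map_one]
    simp only [repFree_vert]
    ext i j
    rw [Matrix.sum_apply]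
    by_cases hij : i = j
    · subst hij; simp [Matrix.single_apply]
    · rw [Matrix.one_apply_ne hij]
      refine Finset.sum_eq_zero fun v _ => ?_
      rw [Matrix.single_apply, if_neg]
      rintro ⟨rfl, rfl⟩; exact hij rfl
  | source u v =>
    rw [map_mul, repFree_vert, repFree_arr]; split_ifs <;> simp
  | target u v =>
    rw [map_mul, repFree_vert, repFree_arr]; split_ifs <;> simp
  | no_arrow u v huv =>
    rw [repFree_arr, if_neg (fun hα => huv (h.arrow _ _ hα)), map_zero]
  | zero_path p hp =>
    obtain _ | ⟨u, l⟩ := p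
    -- The empty list is a chain for every `α`, so it cannot be a zero relation.
    · exact absurd (by simp) (h.zero _ hp)
    · rw [repFree_word, if_neg (h.zero _ hp), map_zero]
  | comm_paths p q hpq =>
    have h1 := h.head _ hpq
    have h2 := h.last _ hpq
    have h3 := h.ne_nil _ hpq
    have h4 := h.comm _ hpq
    obtain _ | ⟨u, l⟩ := p
    · simp at h3
    obtain _ | ⟨u', l'⟩ := q
    · simp at h1
    simp only [List.head?_cons, Option.some.injEq] at h1
    subst h1
    simp only at h4
    simp only [List.getLast?_eq_getLast_of_ne_nil (List.cons_ne_nil _ _), Option.some.injEq] at h2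
    rw [repFree_word, repFree_word, h2]
    simp only [h4]

/-- The representation of `K Q / I` given by `α`. -/
noncomputable def IsRep.rep (h : IsRep α) : Q.Alg K →ₐ[K] Matrix Q.V Q.V K :=
  RingQuot.liftAlgHom K ⟨Q.repFree K α, fun _ _ hxy => h.repFree_rel K hxy⟩

lemma IsRep.rep_mk (h : IsRep α) (x : Q.Free K) :
    h.rep K (RingQuot.mkAlgHom K (Q.Rel K) x) = Q.repFree K α x := by
  simp [IsRep.rep]

end Representation

/-- A basis of `K Q / I` consisting of at most one element `b i j` for every pair of vertices: the
products of the `b i j` with the arrows are determined by the relations `α i`, and `b i j = 0` unless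
`j` is reached from `i` by arrows in `α i`. -/
structure PeirceBasis where
  α : Q.V → Q.V → Q.V → Prop
  isRep : ∀ i, IsRep (α i)
  b : Q.V → Q.V → Q.Alg K
  b_self : ∀ i, b i i = Q.idem K i
  b_mul_idem : ∀ i j, b i j * Q.idem K j = b i j
  b_mul_pos : ∀ i j k, Relation.ReflTransGen (α i) i j → α i j k →
    b i j * Q.arrow K j k = b i k
  b_mul_neg : ∀ i j k, Relation.ReflTransGen (α i) i j → ¬ α i j k →
    b i j * Q.arrow K j k = 0
  b_zero : ∀ i j, ¬ Relation.ReflTransGen (α i) i j → b i j = 0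

namespace PeirceBasis

variable {K Q} (B : Q.PeirceBasis K)

/-- The pairs `(i, j)` with `b i j ≠ 0`. -/
def R (i j : Q.V) : Prop := Relation.ReflTransGen (B.α i) i j

lemma idem_mul_b (i j : Q.V) : Q.idem K i * B.b i j = B.b i j := by
  by_cases h : B.R i j
  · induction h with
    | refl => simp [B.b_self]
    | tail hab hα ih =>
      rw [← B.b_mul_pos i _ _ hab hα, ← mul_assoc, ih]
  · rw [B.b_zero i j h, mul_zero]

/-- Every step along an arrow of `α i` multiplies by a matrix unit. The representation thus detects
`b i j`, which is how its nonvanishing is proved. -/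
lemma rep_b (i j : Q.V) (h : B.R i j) : (B.isRep i).rep K (B.b i j) = Matrix.single i j 1 := by
  induction h with
  | refl => rw [B.b_self, idem, IsRep.rep_mk, repFree_vert]
  | tail hab hα ih =>
    rw [← B.b_mul_pos i _ _ hab hα, map_mul, ih, arrow, IsRep.rep_mk, repFree_arr, if_pos hα]
    simp

lemma b_ne_zero (i j : Q.V) (h : B.R i j) : B.b i j ≠ 0 := by
  intro h0
  have := B.rep_b i j h
  rw [h0, map_zero] at this
  have := congrFun (congrFun this i) j
  simp at this

lemma b_mul_idem_of_ne {i j k : Q.V} (h : j ≠ k) : B.b i j * Q.idem K k = 0 := by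
  rw [← B.b_mul_idem, mul_assoc, Q.idem_mul_of_ne K h, mul_zero]

lemma b_mul_arrow_mem (i j u v : Q.V) :
    B.b i j * Q.arrow K u v ∈ Submodule.span K (Set.range (B.b i)) := by
  by_cases hj : j = u
  · subst hj
    by_cases hR : B.R i j
    · by_cases hα : B.α i j v
      · rw [B.b_mul_pos i j v hR hα]; exact Submodule.subset_span ⟨v, rfl⟩
      · rw [B.b_mul_neg i j v hR hα]; exact zero_mem _
    · rw [B.b_zero i j hR, zero_mul]; exact zero_mem _
  · rw [← Q.idem_mul_arrow K, ← mul_assoc, B.b_mul_idem_of_ne hj, zero_mul]; exact zero_mem _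

/-- The span is stable under right multiplication by the generators, hence by the whole algebra. The
induction keeps `y` general, because a product acts one factor at a time. -/
lemma mul_mem_span (i : Q.V) (x : Q.Alg K) (y : Q.Alg K)
    (hy : y ∈ Submodule.span K (Set.range (B.b i))) :
    y * x ∈ Submodule.span K (Set.range (B.b i)) := by
  obtain ⟨x, rfl⟩ := RingQuot.mkAlgHom_surjective K (Q.Rel K) x
  induction x using FreeAlgebra.induction generalizing y with
  | grade0 r =>
    rw [AlgHom.commutes, ← Algebra.commutes, ← Algebra.smul_def]
    exact Submodule.smul_mem _ _ hy
  | add a c ha hc => rw [map_add, mul_add]; exact add_mem (ha y hy) (hc y hy)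
  | mul a c ha hc => rw [map_mul, ← mul_assoc]; exact hc _ (ha y hy)
  | grade1 g =>
    induction hy using Submodule.span_induction with
    | zero => rw [zero_mul]; exact zero_mem _
    | add a c _ _ ha hc => rw [add_mul]; exact add_mem ha hc
    | smul r a _ ha => rw [smul_mul_assoc]; exact Submodule.smul_mem _ _ ha
    | mem y hy =>
      obtain ⟨j, rfl⟩ := hy
      obtain v | ⟨u, v⟩ := g
      · change B.b i j * Q.idem K v ∈ _
        by_cases hj : j = v
        · subst hj; rw [B.b_mul_idem]; exact Submodule.subset_span ⟨j, rfl⟩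
        · rw [B.b_mul_idem_of_ne hj]; exact zero_mem _
      · exact B.b_mul_arrow_mem i j u v

lemma idem_mul_mem_span (i : Q.V) (x : Q.Alg K) :
    Q.idem K i * x ∈ Submodule.span K (Set.range (B.b i)) :=
  B.mul_mem_span i x _ (Submodule.subset_span ⟨i, B.b_self i⟩)

include B in
lemma finite : Module.Finite K (Q.Alg K) := by
  refine ⟨Submodule.fg_def.mpr
    ⟨Set.range fun p : Q.V × Q.V => B.b p.1 p.2, Set.finite_range _, ?_⟩⟩
  rw [eq_top_iff]
  rintro x -
  rw [← one_mul x, ← Q.sum_idem K, Finset.sum_mul]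
  refine sum_mem fun i _ => Submodule.span_mono ?_ (B.idem_mul_mem_span i x)
  rintro _ ⟨j, rfl⟩
  exact ⟨(i, j), rfl⟩

lemma exists_smul_of_mul_idem (i j : Q.V) (x : Q.Alg K)
    (hx : x ∈ Submodule.span K (Set.range (B.b i))) : ∃ c : K, x * Q.idem K j = c • B.b i j := by
  induction hx using Submodule.span_induction with
  | zero => exact ⟨0, by simp⟩
  | add a c _ _ ha hc =>
    obtain ⟨r, hr⟩ := ha
    obtain ⟨s, hs⟩ := hc
    exact ⟨r + s, by rw [add_mul, hr, hs, add_smul]⟩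
  | smul r a _ ha =>
    obtain ⟨s, hs⟩ := ha
    exact ⟨r * s, by rw [smul_mul_assoc, hs, mul_smul]⟩
  | mem y hy =>
    obtain ⟨k, rfl⟩ := hy
    by_cases hk : k = j
    · subst hk; exact ⟨1, by rw [B.b_mul_idem, one_smul]⟩
    · exact ⟨0, by rw [B.b_mul_idem_of_ne hk, zero_smul]⟩

end PeirceBasis

lemma mem_proj {i : Q.V} {x : Q.Alg K} : x ∈ Q.proj K i ↔ ∃ a, Q.idem K i * a = x := by
  rw [Submodule.mem_span_singleton]
  exact ⟨fun ⟨a, ha⟩ => ⟨a.unop, ha⟩, fun ⟨a, ha⟩ => ⟨MulOpposite.op a, ha⟩⟩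

/-- The generator `e_i` of `P_i`. -/
def projGen (i : Q.V) : Q.proj K i := ⟨Q.idem K i, Submodule.mem_span_singleton_self _⟩

variable {K Q}

lemma proj_hom_ext {i j : Q.V} {f g : Q.proj K j →ₗ[(Q.Alg K)ᵐᵒᵖ] Q.proj K i}
    (h : f (Q.projGen K j) = g (Q.projGen K j)) : f = g := by
  refine LinearMap.ext ?_
  rintro ⟨x, hx⟩
  obtain ⟨a, rfl⟩ := (Q.mem_proj K).1 hx
  have : (⟨Q.idem K j * a, hx⟩ : Q.proj K j) = MulOpposite.op a • Q.projGen K j := rfl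
  rw [this, map_smul, map_smul, h]

lemma proj_hom_gen {i j : Q.V} (f : Q.proj K j →ₗ[(Q.Alg K)ᵐᵒᵖ] Q.proj K i) :
    (f (Q.projGen K j) : Q.Alg K) * Q.idem K j = f (Q.projGen K j) := by
  have : MulOpposite.op (Q.idem K j) • Q.projGen K j = Q.projGen K j :=
    Subtype.ext (Q.idem_mul_self K j)
  conv_rhs => rw [← this, map_smul]
  rfl

namespace PeirceBasis

variable (B : Q.PeirceBasis K)

/-- Left multiplication by `b i j` from `P_j` to `P_i`. -/
noncomputable def homOf (i j : Q.V) : Q.proj K j →ₗ[(Q.Alg K)ᵐᵒᵖ] Q.proj K i where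
  toFun x := ⟨B.b i j * x, (Q.mem_proj K).2 ⟨B.b i j * x, by rw [← mul_assoc, B.idem_mul_b]⟩⟩
  map_add' x y := Subtype.ext (mul_add _ _ _)
  map_smul' a x := Subtype.ext (by
    change B.b i j * ((x : Q.Alg K) * a.unop) = B.b i j * (x : Q.Alg K) * a.unop
    rw [mul_assoc])

lemma homOf_gen (i j : Q.V) : (B.homOf i j (Q.projGen K j) : Q.Alg K) = B.b i j :=
  B.b_mul_idem i j

/-- A homomorphism is determined by the image of `e_j`, which lies in `e_i A e_j`, and this space is
spanned by `b i j`. -/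
lemma hom_eq_smul {i j : Q.V} (f : Q.proj K j →ₗ[(Q.Alg K)ᵐᵒᵖ] Q.proj K i) :
    ∃ c : K, c • B.homOf i j = f := by
  obtain ⟨a, ha⟩ := (Q.mem_proj K).1 (f (Q.projGen K j)).2
  obtain ⟨c, hc⟩ := B.exists_smul_of_mul_idem i j _ (B.idem_mul_mem_span i a)
  refine ⟨c, proj_hom_ext (Subtype.ext ?_)⟩
  rw [← proj_hom_gen f, ← ha, hc, ← B.homOf_gen i j]
  rfl

open Classical in
/-- The Cartan matrix of an algebra with a Peirce basis. -/
theorem cartan_apply (i j : Q.V) : Q.cartan K i j = if B.R i j then 1 else 0 := by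
  rw [cartan, Matrix.of_apply]
  split_ifs with h
  · have hbij : Function.Bijective (LinearMap.toSpanSingleton K
        (Q.proj K j →ₗ[(Q.Alg K)ᵐᵒᵖ] Q.proj K i) (B.homOf i j)) := by
      refine ⟨fun c d hcd => ?_, B.hom_eq_smul⟩
      have h1 : c • B.homOf i j = d • B.homOf i j := hcd
      have h2 : c • B.b i j = d • B.b i j := by
        rw [← B.homOf_gen i j]
        exact congrArg (fun f => (f (Q.projGen K j) : Q.Alg K)) h1
      exact smul_left_injective K (B.b_ne_zero i j h) h2
    rw [← (LinearEquiv.ofBijective _ hbij).finrank_eq, Module.finrank_self]; rfl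
  · have : Subsingleton (Q.proj K j →ₗ[(Q.Alg K)ᵐᵒᵖ] Q.proj K i) := by
      refine ⟨fun f g => ?_⟩
      have h0 : B.homOf i j = 0 :=
        proj_hom_ext (Subtype.ext ((B.homOf_gen i j).trans (B.b_zero i j h)))
      obtain ⟨c, rfl⟩ := B.hom_eq_smul f
      obtain ⟨d, rfl⟩ := B.hom_eq_smul g
      rw [h0, smul_zero, smul_zero]
    rw [Module.finrank_zero_of_subsingleton]; rfl

end PeirceBasis

end PeirceBasis

/-! ### Relabelling the vertices -/

section Transport

variable {K : Type*} [Field K] {Q : BoundQuiver} {I : Type*} (E : I ≃ Q.V)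

lemma isChain_map_equiv (β : I → I → Prop) (l : List I) :
    (l.map E).IsChain (fun u v => β (E.symm u) (E.symm v)) ↔ l.IsChain β := by
  rw [List.isChain_map]; simp

/-- A Peirce basis from data indexed by a type `I` in bijection with the vertices. -/
def PeirceBasis.ofEquiv (α : I → I → I → Prop)
    (isRep : ∀ i, IsRep (fun u v => α i (E.symm u) (E.symm v)))
    (b : I → I → Q.Alg K) (b_self : ∀ i, b i i = Q.idem K (E i))
    (b_mul_idem : ∀ i j, b i j * Q.idem K (E j) = b i j)
    (R : I → I → Prop) (hR : ∀ i j, Relation.ReflTransGen (α i) i j ↔ R i j)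
    (b_mul_pos : ∀ i j k, R i j → α i j k → b i j * Q.arrow K (E j) (E k) = b i k)
    (b_mul_neg : ∀ i j k, R i j → ¬ α i j k → b i j * Q.arrow K (E j) (E k) = 0)
    (b_zero : ∀ i j, ¬ R i j → b i j = 0) : Q.PeirceBasis K :=
  have key : ∀ i j, Relation.ReflTransGen (fun u v => α (E.symm i) (E.symm u) (E.symm v)) i j ↔
      R (E.symm i) (E.symm j) := fun i j => by
    rw [← hR]
    constructor
    · exact fun h => h.lift E.symm fun _ _ h => h
    · intro h
      have := h.lift (p := fun u v => α (E.symm i) (E.symm u) (E.symm v)) E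
        fun a b h => by simpa [Function.onFun] using h
      simpa [Function.onFun] using this
  { α := fun i u v => α (E.symm i) (E.symm u) (E.symm v)
    isRep := fun i => isRep (E.symm i)
    b := fun i j => b (E.symm i) (E.symm j)
    b_self := fun i => by simp [b_self]
    b_mul_idem := fun i j => by simpa using b_mul_idem (E.symm i) (E.symm j)
    b_mul_pos := fun i j k h h' => by
      simpa using b_mul_pos (E.symm i) (E.symm j) (E.symm k) ((key i j).1 h) h'
    b_mul_neg := fun i j k h h' => by
      simpa using b_mul_neg (E.symm i) (E.symm j) (E.symm k) ((key i j).1 h) h'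
    b_zero := fun i j h => b_zero _ _ fun h' => h ((key i j).2 h') }

lemma PeirceBasis.ofEquiv_R {α : I → I → I → Prop} {isRep} {b : I → I → Q.Alg K} {b_self}
    {b_mul_idem} {R : I → I → Prop} {hR : ∀ i j, Relation.ReflTransGen (α i) i j ↔ R i j}
    {b_mul_pos b_mul_neg b_zero} (i j : I) :
    (PeirceBasis.ofEquiv E α isRep b b_self b_mul_idem R hR b_mul_pos b_mul_neg b_zero).R
      (E i) (E j) ↔ R i j := by
  rw [← hR]
  constructor
  · intro h
    have h : Relation.ReflTransGen (fun u v => α (E.symm (E i)) (E.symm u) (E.symm v))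
      (E i) (E j) := h
    have := h.lift (p := α i) E.symm fun a b h => by simpa [Function.onFun] using h
    simpa [Function.onFun] using this
  · intro h
    exact h.lift E fun a b h => by simpa [PeirceBasis.ofEquiv, Function.onFun] using h

end Transport

/-! ### Vertices of a gluing -/

section Glue

variable (S : BoundQuiver) {r : ℕ} (c : Fin r → S.V) (R : Fin r → BoundQuiver)
  (v : (j : Fin r) → (R j).V)

lemma glueMap_root (j : Fin r) : glueMap S c R v j (v j) = Sum.inl (c j) := by simp [glueMap]

lemma glueMap_of_ne {j : Fin r} {x : (R j).V} (h : x ≠ v j) :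
    glueMap S c R v j x = Sum.inr ⟨j, x, h⟩ := by simp [glueMap, h]

lemma eq_of_inl_eq_glueMap {a : S.V} {j : Fin r} {x : (R j).V}
    (h : Sum.inl a = glueMap S c R v j x) : a = c j := by
  by_cases hx : x = v j
  · rw [hx, glueMap_root] at h; exact Sum.inl_injective h
  · rw [glueMap_of_ne S c R v hx] at h; cases h

/-- Away from the roots nothing is identified, and roots of different glued quivers stay apart
because `c` is injective. -/
lemma glueMap_injective (hc : Function.Injective c) :
    Function.Injective fun x : (Σ j, (R j).V) => glueMap S c R v x.1 x.2 := by
  rintro ⟨j, x⟩ ⟨k, y⟩ h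
  change glueMap S c R v j x = glueMap S c R v k y at h
  by_cases hx : x = v j
  · rw [hx, glueMap_root] at h
    have := eq_of_inl_eq_glueMap S c R v h
    obtain rfl := hc this
    by_cases hy : y = v j
    · rw [hx, hy]
    · rw [glueMap_of_ne S c R v hy] at h; cases h
  · rw [glueMap_of_ne S c R v hx] at h
    by_cases hy : y = v k
    · rw [hy, glueMap_root] at h; cases h
    · rw [glueMap_of_ne S c R v hy] at h; cases h; rfl

lemma exists_glueMap (x : GlueV S R v) :
    (∃ a, x = Sum.inl a) ∨ ∃ j y, x = glueMap S c R v j y := by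
  obtain a | ⟨j, y, hy⟩ := x
  · exact Or.inl ⟨a, rfl⟩
  · exact Or.inr ⟨j, y, (glueMap_of_ne S c R v hy).symm⟩

end Glue

/-! ### The two-spike quiver: vertices, arrows, relations -/

/-- The quiver with relations of type IV with two spikes, at opposite arrows of a central cycle of
length six, and quivers of type `A` in standard form glued to them. -/
abbrev twoSpike (s t : Fin 2 → ℕ) : BoundQuiver :=
  glue (skeletonIV 6 2 fun j => 3 * j) (fun j => Sum.inr j) (fun j => typeA (s j) (t j))
    (fun j => rootA (s j) (t j))

namespace TwoSpike

variable {s t : Fin 2 → ℕ}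

/-- The vertices of `twoSpike s t`: those of the central cycle, and those of the quivers glued to
the spikes. -/
abbrev Vert (s t : Fin 2 → ℕ) : Type :=
  Fin 6 ⊕ (Σ j : Fin 2, Fin (s j + t j + 1) ⊕ Fin (t j))

/-- The inclusion of the skeleton. -/
def ofSkeleton : Fin 6 ⊕ Fin 2 → Vert s t
  | Sum.inl a => Sum.inl a
  | Sum.inr j => Sum.inr ⟨j, Sum.inl 0⟩

/-- The inclusion of the `j`-th glued quiver. -/
def ofTail (j : Fin 2) (x : Fin (s j + t j + 1) ⊕ Fin (t j)) : Vert s t := Sum.inr ⟨j, x⟩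

/-- The inclusion of the skeleton into the gluing. -/
def skel (s t : Fin 2 → ℕ) (x : Fin 6 ⊕ Fin 2) : (twoSpike s t).V :=
  (Sum.inl x : GlueV (skeletonIV 6 2 fun j => 3 * j) (fun j => typeA (s j) (t j))
    (fun j => rootA (s j) (t j)))

/-- The inclusion of the `j`-th glued quiver into the gluing. -/
def tail (s t : Fin 2 → ℕ) (j : Fin 2) (x : Fin (s j + t j + 1) ⊕ Fin (t j)) :
    (twoSpike s t).V :=
  glueMap (skeletonIV 6 2 fun j => 3 * j) (fun j => Sum.inr j)
    (fun j => typeA (s j) (t j)) (fun j => rootA (s j) (t j)) j x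

lemma tail_root (j : Fin 2) : tail s t j (Sum.inl 0) = skel s t (Sum.inr j) :=
  glueMap_root (skeletonIV 6 2 fun j => 3 * j) (fun j => Sum.inr j)
    (fun j => typeA (s j) (t j)) (fun j => rootA (s j) (t j)) j

/-- The vertices of the gluing. -/
def toGlue (s t : Fin 2 → ℕ) : Vert s t → (twoSpike s t).V
  | Sum.inl a => skel s t (Sum.inl a)
  | Sum.inr ⟨j, x⟩ => tail s t j x

lemma toGlue_bijective : Function.Bijective (toGlue s t) := by
  constructor
  · rintro (a | ⟨j, x⟩) (b | ⟨k, y⟩) h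
    · exact congrArg _ (Sum.inl_injective (Sum.inl_injective h))
    · have := eq_of_inl_eq_glueMap (skeletonIV 6 2 fun j => 3 * j) (fun j => Sum.inr j)
        (fun j => typeA (s j) (t j)) (fun j => rootA (s j) (t j)) h
      cases this
    · have := eq_of_inl_eq_glueMap (skeletonIV 6 2 fun j => 3 * j) (fun j => Sum.inr j)
        (fun j => typeA (s j) (t j)) (fun j => rootA (s j) (t j)) h.symm
      cases this
    · exact congrArg Sum.inr (glueMap_injective (skeletonIV 6 2 fun j => 3 * j)
        (fun j => Sum.inr j) (fun j => typeA (s j) (t j)) (fun j => rootA (s j) (t j))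
        Sum.inr_injective h)
  · intro x
    obtain ⟨a | j, h⟩ | ⟨j, y, h⟩ := exists_glueMap (skeletonIV 6 2 fun j => 3 * j)
      (fun j => Sum.inr j) (fun j => typeA (s j) (t j)) (fun j => rootA (s j) (t j)) x
    · exact ⟨Sum.inl a, h.symm⟩
    · exact ⟨Sum.inr ⟨j, Sum.inl 0⟩, (tail_root j).trans h.symm⟩
    · exact ⟨Sum.inr ⟨j, y⟩, h.symm⟩

/-- The vertices of the gluing. -/
noncomputable def equiv (s t : Fin 2 → ℕ) : Vert s t ≃ (twoSpike s t).V :=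
  Equiv.ofBijective _ toGlue_bijective

lemma equiv_ofSkeleton (x : Fin 6 ⊕ Fin 2) : equiv s t (ofSkeleton x) = skel s t x := by
  obtain a | j := x
  · rfl
  · exact tail_root (s := s) (t := t) j

lemma equiv_ofTail (j : Fin 2) (x) : equiv s t (ofTail j x) = tail s t j x := rfl

/-- The arrows of the skeleton. -/
abbrev SkelArrow : Fin 6 ⊕ Fin 2 → Fin 6 ⊕ Fin 2 → Prop :=
  (skeletonIV 6 2 fun j => 3 * j).Arrow

/-- The arrows of the `j`-th glued quiver. -/
abbrev TailArrow (s t : ℕ) : Fin (s + t + 1) ⊕ Fin t → Fin (s + t + 1) ⊕ Fin t → Prop :=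
  (typeA s t).Arrow

/-- The zero relations of the skeleton. -/
abbrev skelZero : Set (List (Fin 6 ⊕ Fin 2)) := (skeletonIV 6 2 fun j => 3 * j).zero

/-- The commutativity relations of the skeleton. -/
abbrev skelComm : Set (List (Fin 6 ⊕ Fin 2) × List (Fin 6 ⊕ Fin 2)) :=
  (skeletonIV 6 2 fun j => 3 * j).comm

/-- The zero relations of a glued quiver. -/
abbrev tailZero (s t : ℕ) : Set (List (Fin (s + t + 1) ⊕ Fin t)) := (typeA s t).zero

/-- The arrows of `twoSpike s t`. -/
def Adj : Vert s t → Vert s t → Prop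
  | Sum.inl a, Sum.inl b => b = a + 1
  | Sum.inl a, Sum.inr ⟨j, Sum.inl q⟩ => (a : ℕ) = 3 * j + 1 ∧ (q : ℕ) = 0
  | Sum.inr ⟨j, Sum.inl q⟩, Sum.inl a => (a : ℕ) = 3 * j ∧ (q : ℕ) = 0
  | Sum.inr ⟨j, Sum.inl q⟩, Sum.inr ⟨k, Sum.inl q'⟩ => j = k ∧ (q' : ℕ) = q + 1
  | Sum.inr ⟨j, Sum.inl q⟩, Sum.inr ⟨k, Sum.inr p⟩ => j = k ∧ (q : ℕ) = s j + p + 1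
  | Sum.inr ⟨j, Sum.inr p⟩, Sum.inr ⟨k, Sum.inl q⟩ => j = k ∧ (q : ℕ) = s j + p
  | _, _ => False

lemma arrow_iff_exists (x y : Vert s t) : (twoSpike s t).Arrow (equiv s t x) (equiv s t y) ↔
    (∃ a b, SkelArrow a b ∧ x = ofSkeleton a ∧ y = ofSkeleton b) ∨
    ∃ j a b, TailArrow (s j) (t j) a b ∧ x = ofTail j a ∧ y = ofTail j b := by
  simp only [← (equiv s t).injective.eq_iff, equiv_ofSkeleton, equiv_ofTail]
  exact Iff.rfl

lemma arrow_iff (x y : Vert s t) :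
    (twoSpike s t).Arrow (equiv s t x) (equiv s t y) ↔ Adj x y := by
  rw [arrow_iff_exists]
  constructor
  · rintro (⟨a | j, b | k, h, rfl, rfl⟩ | ⟨j, a | p, b | p', h, rfl, rfl⟩)
    · have h : (b : ℕ) = (a + 1) % 6 := h
      exact Fin.ext (by rw [h, Fin.val_add]; rfl)
    · have h : (a : ℕ) = (3 * k + 1) % 6 := h
      exact ⟨by omega, rfl⟩
    · exact ⟨h, rfl⟩
    · exact h.elim
    · exact ⟨rfl, h⟩
    · exact ⟨rfl, h⟩
    · exact ⟨rfl, h⟩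
    · exact h.elim
  · intro h
    rcases x with a | ⟨j, q | p⟩ <;> rcases y with b | ⟨k, q' | p'⟩ <;> simp only [Adj] at h
    · refine Or.inl ⟨Sum.inl a, Sum.inl b, ?_, rfl, rfl⟩
      change (b : ℕ) = (a + 1) % 6
      rw [h, Fin.val_add]; rfl
    · refine Or.inl ⟨Sum.inl a, Sum.inr k, ?_, rfl, ?_⟩
      · change (a : ℕ) = (3 * k + 1) % 6
        omega
      · rw [show q' = 0 from Fin.ext h.2]; rfl
    · refine Or.inl ⟨Sum.inr j, Sum.inl b, h.1, ?_, rfl⟩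
      rw [show q = 0 from Fin.ext h.2]; rfl
    · obtain ⟨rfl, h⟩ := h
      exact Or.inr ⟨j, Sum.inl q, Sum.inl q', h, rfl, rfl⟩
    · obtain ⟨rfl, h⟩ := h
      exact Or.inr ⟨j, Sum.inl q, Sum.inr p', h, rfl, rfl⟩
    · obtain ⟨rfl, h⟩ := h
      exact Or.inr ⟨j, Sum.inr p, Sum.inl q', h, rfl, rfl⟩

lemma equiv_comp_ofSkeleton : equiv s t ∘ ofSkeleton = skel s t := funext equiv_ofSkeleton

lemma mem_zero {p : List (twoSpike s t).V} : p ∈ (twoSpike s t).zero ↔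
    (∃ q ∈ skelZero, p = (q.map ofSkeleton).map (equiv s t)) ∨
    ∃ j, ∃ q ∈ tailZero (s j) (t j), p = (q.map (ofTail j)).map (equiv s t) := by
  simp only [List.map_map, equiv_comp_ofSkeleton]
  exact Iff.rfl

lemma mem_comm {p : List (twoSpike s t).V × List (twoSpike s t).V} : p ∈ (twoSpike s t).comm ↔
    ∃ q ∈ skelComm,
      p = ((q.1.map ofSkeleton).map (equiv s t), (q.2.map ofSkeleton).map (equiv s t)) := by
  simp only [List.map_map, equiv_comp_ofSkeleton]
  refine ⟨?_, Or.inl⟩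
  rintro (h | ⟨j, q, hq, -⟩)
  · exact h
  · exact hq.elim

lemma centralPath_six (x : Fin 6) : centralPath x = [x + 1, x + 2, x + 3, x + 4, x + 5, x] := by
  revert x; decide

/-- The arrows acting as the identity on the projective representation at a vertex. -/
def Step : Vert s t → Vert s t → Vert s t → Prop
  | Sum.inl a, Sum.inl x, Sum.inl y => y = x + 1 ∧ (x ≠ a + 5 ∧ (x = a + 4 → a = 1 ∨ a = 4))
  | Sum.inl a, Sum.inl x, Sum.inr ⟨j, Sum.inl q⟩ => a = x ∧ (x : ℕ) = 3 * j + 1 ∧ (q : ℕ) = 0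
  | Sum.inl a, Sum.inr ⟨j, Sum.inl q⟩, Sum.inl x =>
      (a : ℕ) = 3 * j + 1 ∧ (x : ℕ) = 3 * j ∧ (q : ℕ) = 0
  | Sum.inl a, Sum.inr ⟨j, Sum.inl q⟩, Sum.inr ⟨k, Sum.inl q'⟩ =>
      (a : ℕ) = 3 * j + 1 ∧ j = k ∧ (q' : ℕ) = q + 1
  | Sum.inr ⟨i, Sum.inl q₀⟩, Sum.inr ⟨j, Sum.inl q⟩, Sum.inl x =>
      i = j ∧ (q₀ : ℕ) = 0 ∧ (x : ℕ) = 3 * j ∧ (q : ℕ) = 0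
  | Sum.inr ⟨i, Sum.inl q₀⟩, Sum.inr ⟨j, Sum.inl q⟩, Sum.inr ⟨k, Sum.inl q'⟩ =>
      i = j ∧ (q₀ : ℕ) ≤ q ∧ j = k ∧ (q' : ℕ) = q + 1
  | Sum.inr ⟨i, Sum.inl q₀⟩, Sum.inr ⟨j, Sum.inl q⟩, Sum.inr ⟨k, Sum.inr p⟩ =>
      i = j ∧ (q₀ : ℕ) = q ∧ j = k ∧ (q : ℕ) = s j + p + 1
  | Sum.inr ⟨i, Sum.inr p₀⟩, Sum.inr ⟨j, Sum.inl q⟩, Sum.inl x =>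
      i = j ∧ s i + p₀ = 0 ∧ (x : ℕ) = 3 * j ∧ (q : ℕ) = 0
  | Sum.inr ⟨i, Sum.inr p₀⟩, Sum.inr ⟨j, Sum.inl q⟩, Sum.inr ⟨k, Sum.inr p⟩ =>
      i = j ∧ (p₀ : ℕ) = p + 1 ∧ j = k ∧ (q : ℕ) = s j + p + 1
  | Sum.inr ⟨i, Sum.inr p₀⟩, Sum.inr ⟨j, Sum.inr p⟩, Sum.inr ⟨k, Sum.inl q⟩ =>
      i = j ∧ (p₀ : ℕ) = p ∧ j = k ∧ (q : ℕ) = s j + p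
  | _, _, _ => False

lemma Step.adj {i x y : Vert s t} (h : Step i x y) : Adj x y := by
  rcases i with a | ⟨i, q₀ | p₀⟩ <;> rcases x with x | ⟨j, q | p⟩ <;>
    rcases y with y | ⟨k, q' | p'⟩ <;> simp only [Step] at h <;> simp only [Adj] <;> tauto

/-- The vertices in the support of the projective representation at a vertex. -/
def Reach : Vert s t → Vert s t → Prop
  | Sum.inl a, Sum.inl x => x = a + 5 → a = 1 ∨ a = 4
  | Sum.inl a, Sum.inr ⟨j, Sum.inl _⟩ => (a : ℕ) = 3 * j + 1
  | Sum.inl _, Sum.inr ⟨_, Sum.inr _⟩ => False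
  | Sum.inr ⟨j, Sum.inl q⟩, Sum.inl x => (x : ℕ) = 3 * j ∧ (q : ℕ) = 0
  | Sum.inr ⟨j, Sum.inl q⟩, Sum.inr ⟨k, Sum.inl q'⟩ => j = k ∧ (q : ℕ) ≤ q'
  | Sum.inr ⟨j, Sum.inl q⟩, Sum.inr ⟨k, Sum.inr p⟩ => j = k ∧ (q : ℕ) = s j + p + 1
  | Sum.inr ⟨j, Sum.inr p⟩, Sum.inl x => (x : ℕ) = 3 * j ∧ s j + p = 0
  | Sum.inr ⟨j, Sum.inr p⟩, Sum.inr ⟨k, Sum.inl q⟩ => j = k ∧ (q : ℕ) = s j + p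
  | Sum.inr ⟨j, Sum.inr p⟩, Sum.inr ⟨k, Sum.inr p'⟩ =>
      j = k ∧ ((p : ℕ) = p' ∨ (p : ℕ) = p' + 1)

variable {s t : Fin 2 → ℕ}

section Rep

lemma skelZero_cases {P : List (Fin 6 ⊕ Fin 2) → Prop}
    (h1 : ∀ (j : Fin 2) (x : Fin 6), (x : ℕ) = 3 * j → P [Sum.inl x, Sum.inl (x + 1), Sum.inr j])
    (h2 : ∀ (j : Fin 2) (x : Fin 6), (x : ℕ) = 3 * j → P [Sum.inr j, Sum.inl x, Sum.inl (x + 1)])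
    (h3 : ∀ x : Fin 6, x ≠ 0 → x ≠ 3 → P [Sum.inl (x + 1), Sum.inl (x + 2), Sum.inl (x + 3),
      Sum.inl (x + 4), Sum.inl (x + 5), Sum.inl x]) {q} (hq : q ∈ skelZero) : P q := by
  obtain ⟨j, x, y, hx, hy, rfl | rfl⟩ | ⟨x, hx, rfl⟩ := hq
  · obtain rfl : y = x + 1 := Fin.ext (by rw [hy, Fin.val_add, hx]; rfl)
    exact h1 j x hx
  · obtain rfl : y = x + 1 := Fin.ext (by rw [hy, Fin.val_add, hx]; rfl)
    exact h2 j x hx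
  · rw [centralPath_six]
    exact h3 x (fun h => hx 0 (by rw [h]; rfl)) (fun h => hx 1 (by rw [h]; rfl))

lemma skelComm_cases {P : List (Fin 6 ⊕ Fin 2) × List (Fin 6 ⊕ Fin 2) → Prop}
    (h : ∀ (j : Fin 2) (x : Fin 6), (x : ℕ) = 3 * j →
      P ([Sum.inl (x + 1), Sum.inr j, Sum.inl x], [Sum.inl (x + 1), Sum.inl (x + 2),
        Sum.inl (x + 3), Sum.inl (x + 4), Sum.inl (x + 5), Sum.inl x])) {q} (hq : q ∈ skelComm) :
    P q := by
  obtain ⟨j, x, y, hx, hy, rfl⟩ := hq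
  obtain rfl : y = x + 1 := Fin.ext (by rw [hy, Fin.val_add, hx]; rfl)
  rw [centralPath_six]
  exact h j x hx

/-- `Step i` selects the arrows acting nontrivially on the projective at `i`. No zero relation runs
entirely inside it. Of the two sides of a commutativity relation, both run inside it (when `i` is
their common source) or neither does. -/
lemma isRep_step (i : Vert s t) :
    IsRep (fun u v => Step i ((equiv s t).symm u) ((equiv s t).symm v)) := by
  refine ⟨fun u v h => ?_, fun p hp => ?_, fun p hp => ?_, fun p hp => ?_, fun p hp => ?_,
    fun p hp => ?_⟩
  · simpa using (arrow_iff _ _).2 h.adj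
  · obtain ⟨q, hq, rfl⟩ | ⟨j, q, hq, rfl⟩ := mem_zero.1 hp
    · rw [isChain_map_equiv, List.isChain_map]
      refine skelZero_cases (P := fun q => ¬ q.IsChain fun u v => Step i (ofSkeleton u) (ofSkeleton v))
        (fun j x hx => ?_) (fun j x hx => ?_) (fun x h0 h3 => ?_) hq
      · rcases i with a | ⟨i, q₀ | p₀⟩ <;>
          simp only [ofSkeleton, Step, List.isChain_cons_cons, not_and, false_and, not_false_eq_true]
        -- Entering the spike forces the starting vertex to be `x + 1`, and then `x` is the vertex
        -- `a + 5` from which no step along the cycle is allowed.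
        rintro ⟨-, h1, -⟩ ⟨rfl, -⟩
        exact absurd ((by decide : ∀ x : Fin 6, x = x + 1 + 5) x) h1
      · rcases i with a | ⟨i, q₀ | p₀⟩ <;>
          simp only [ofSkeleton, Step, List.isChain_cons_cons, List.isChain_singleton, not_and,
            false_and, and_false, not_false_eq_true]
        rintro ⟨h1, -, -⟩ ⟨-, h2, -⟩
        exact absurd (Fin.ext (show (x : ℕ) = (a + 5) % 6 by omega)) h2
      · rcases i with a | ⟨i, q₀ | p₀⟩ <;>
          simp only [ofSkeleton, Step, List.isChain_cons_cons, false_and, not_false_eq_true]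
        -- Only the hexagon is left, so this is a finite check.
        revert x a
        simp only [List.isChain_singleton]
        decide
    · rw [isChain_map_equiv, List.isChain_map]
      obtain ⟨p, x, y, hx, hy, rfl | rfl | rfl⟩ := hq <;>
        rcases i with a | ⟨i, q₀ | p₀⟩ <;>
          simp only [ofTail, Step, List.isChain_cons_cons, not_and, false_and, and_false,
            not_false_eq_true, true_and] <;>
          intros <;> omega
  all_goals obtain ⟨q, hq, rfl⟩ := mem_comm.1 hp
  · have := skelComm_cases (P := fun q => q.1.head? = q.2.head?) (by intros; rfl) hq
    simp [this]
  · have := skelComm_cases (P := fun q => q.1.getLast? = q.2.getLast?) (by intros; rfl) hq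
    simp [this]
  · have := skelComm_cases (P := fun q => q.1 ≠ []) (by intros; simp) hq
    simp [this]
  · dsimp only
    rw [isChain_map_equiv, isChain_map_equiv, List.isChain_map, List.isChain_map]
    refine skelComm_cases (P := fun q => (q.1.IsChain fun u v => Step i (ofSkeleton u) (ofSkeleton v))
      ↔ q.2.IsChain fun u v => Step i (ofSkeleton u) (ofSkeleton v)) (fun j x hx => ?_) hq
    rcases i with a | ⟨i, q₀ | p₀⟩ <;>
      simp only [ofSkeleton, Step, List.isChain_cons_cons, false_and, List.isChain_singleton]
    fin_cases j
    · obtain rfl : x = 0 := Fin.ext hx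
      revert a; simp only [Fin.val_zero]; decide
    · obtain rfl : x = 3 := Fin.ext hx
      revert a; simp only [Fin.val_zero]; decide

end Rep

lemma reach_self (i : Vert s t) : Reach i i := by
  rcases i with a | ⟨i, q₀ | p₀⟩ <;> simp only [Reach]
  · revert a; decide
  · simp
  · simp

lemma Reach.step {i j k : Vert s t} (h : Reach i j) (h' : Step i j k) : Reach i k := by
  rcases i with a | ⟨i, q₀ | p₀⟩ <;> rcases j with x | ⟨j, q | p⟩ <;>
    rcases k with y | ⟨k, q' | p'⟩ <;> simp only [Reach, Step] at h h' ⊢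
  · obtain ⟨rfl, h1, h2⟩ := h'
    exact fun h3 => h2 (add_right_cancel
      (h3.trans ((by decide : ∀ a : Fin 6, a + 5 = a + 4 + 1) a)))
  · obtain ⟨rfl, h1, h2⟩ := h'; exact h1
  · intro; omega
  · obtain ⟨h1, rfl, h2⟩ := h'; exact h1
  · obtain ⟨rfl, h1, h2, h3⟩ := h'; exact ⟨h2, h1⟩
  all_goals
    obtain ⟨rfl, h1⟩ := h
    simp only [true_and] at h' ⊢
    omega

lemma reflTransGen_tail {r : Vert s t → Vert s t → Prop} {j : Fin 2} {q₀ : Fin (s j + t j + 1)}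
    (h : ∀ q q' : Fin (s j + t j + 1), (q₀ : ℕ) ≤ q → (q' : ℕ) = q + 1 →
      r (Sum.inr ⟨j, Sum.inl q⟩) (Sum.inr ⟨j, Sum.inl q'⟩)) (q : Fin (s j + t j + 1))
    (hq : (q₀ : ℕ) ≤ q) :
    Relation.ReflTransGen r (Sum.inr ⟨j, Sum.inl q₀⟩) (Sum.inr ⟨j, Sum.inl q⟩) := by
  obtain ⟨q, hlt⟩ := q
  simp only at hq
  induction q, hq using Nat.le_induction with
  | base => exact .refl
  | succ n hn ih => exact (ih (by omega)).tail (h _ _ hn rfl)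

lemma reflTransGen_cycle (a : Fin 6) (k : ℕ) (hk : k ≤ 5) (h : k = 5 → a = 1 ∨ a = 4) :
    Relation.ReflTransGen (Step (s := s) (t := t) (Sum.inl a)) (Sum.inl a)
      (Sum.inl (a + Fin.ofNat 6 k)) := by
  induction k with
  | zero => rw [show a + Fin.ofNat 6 0 = a from add_zero a]
  | succ k ih =>
    refine (ih (by omega) (by omega)).tail ?_
    have hk : k ≤ 4 := by omega
    simp only [Step]
    interval_cases k <;> clear ih <;> revert a <;> decide

lemma reflTransGen_step_iff (i j : Vert s t) :
    Relation.ReflTransGen (Step i) i j ↔ Reach i j := by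
  constructor
  · intro h
    induction h with
    | refl => exact reach_self i
    | tail _ h ih => exact ih.step h
  · intro h
    rcases i with a | ⟨i, q₀ | p₀⟩ <;> rcases j with x | ⟨j, q | p⟩ <;> simp only [Reach] at h
    · have := reflTransGen_cycle (s := s) (t := t) a (x - a : Fin 6).val (by omega)
        (by revert a x; decide)
      simpa using this
    · refine .head (b := Sum.inr ⟨j, Sum.inl 0⟩) ?_ (reflTransGen_tail ?_ q (Nat.zero_le _))
      · exact ⟨rfl, h, rfl⟩
      · exact fun q q' _ h' => ⟨h, rfl, h'⟩
    · exact .single ⟨rfl, h.2, h.1, h.2⟩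
    · obtain ⟨rfl, h⟩ := h
      exact reflTransGen_tail (fun q q' h h' => ⟨rfl, h, rfl, h'⟩) q h
    · obtain ⟨rfl, h⟩ := h
      exact .single ⟨rfl, rfl, rfl, h⟩
    · obtain ⟨h, h'⟩ := h
      refine .head (b := Sum.inr ⟨i, Sum.inl 0⟩) ?_ (.single ?_)
      · exact ⟨rfl, rfl, rfl, h'.symm⟩
      · exact ⟨rfl, h', h, rfl⟩
    · obtain ⟨rfl, h⟩ := h
      exact .single ⟨rfl, rfl, rfl, h⟩
    · obtain ⟨rfl, h | h⟩ := h
      · rw [Fin.ext h]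
      · refine .head (b := Sum.inr ⟨i, Sum.inl ⟨s i + p₀, by omega⟩⟩) ?_ (.single ?_)
        · exact ⟨rfl, rfl, rfl, rfl⟩
        · refine ⟨rfl, h, rfl, ?_⟩
          simp only; omega

/-! ### Paths in the two-spike algebra and their products with arrows -/

variable {s t : Fin 2 → ℕ} (K : Type*) [Field K]

/-- The idempotent at a vertex. -/
noncomputable def e (x : Vert s t) : (twoSpike s t).Alg K := (twoSpike s t).idem K (equiv s t x)

/-- The arrow between two vertices. -/
noncomputable def arr (x y : Vert s t) : (twoSpike s t).Alg K :=
  (twoSpike s t).arrow K (equiv s t x) (equiv s t y)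

@[simp] lemma e_mul_e (x : Vert s t) : e K x * e K x = e K x := idem_mul_self _ _ _

@[simp] lemma e_mul_arr (x y : Vert s t) : e K x * arr K x y = arr K x y := idem_mul_arrow _ _ _ _

@[simp] lemma arr_mul_e (x y : Vert s t) : arr K x y * e K y = arr K x y := arrow_mul_idem _ _ _ _

lemma arr_eq_zero {x y : Vert s t} (h : ¬ Adj x y) : arr K x y = 0 :=
  arrow_eq_zero _ _ fun h' => h ((arrow_iff x y).1 h')

/-- The product of the arrows along a walk. -/
noncomputable def walk (f : ℕ → Vert s t) : ℕ → (twoSpike s t).Alg K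
  | 0 => e K (f 0)
  | k + 1 => walk f k * arr K (f k) (f (k + 1))

@[simp] lemma walk_zero (f : ℕ → Vert s t) : walk K f 0 = e K (f 0) := rfl

lemma walk_succ (f : ℕ → Vert s t) (k : ℕ) :
    walk K f (k + 1) = walk K f k * arr K (f k) (f (k + 1)) := rfl

@[simp] lemma walk_mul_e (f : ℕ → Vert s t) (k : ℕ) : walk K f k * e K (f k) = walk K f k := by
  cases k with
  | zero => simp
  | succ k => rw [walk_succ, mul_assoc, arr_mul_e]

/-- The vertices met on the central cycle. -/
def cyc (s t : Fin 2 → ℕ) (a : Fin 6) (k : ℕ) : Vert s t := Sum.inl (a + Fin.ofNat 6 k)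

lemma cyc_sub (a x : Fin 6) : cyc s t a (x - a).val = Sum.inl x := by
  simp [cyc]

/-- The `q`-th vertex of the linear part of the `j`-th glued quiver. -/
def lin (s t : Fin 2 → ℕ) (j : Fin 2) (q : ℕ) : Vert s t :=
  Sum.inr ⟨j, Sum.inl (Fin.ofNat (s j + t j + 1) q)⟩

lemma lin_val (j : Fin 2) (q : Fin (s j + t j + 1)) :
    lin s t j q = Sum.inr ⟨j, Sum.inl q⟩ := by simp [lin]

section Relations

lemma path_map_eq_zero_of_skel {q : List (Fin 6 ⊕ Fin 2)} (hq : q ∈ skelZero) :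
    (twoSpike s t).path K ((q.map ofSkeleton).map (equiv s t)) = 0 :=
  path_eq_zero _ _ (mem_zero.2 (Or.inl ⟨q, hq, rfl⟩))

lemma path_map_eq_zero_of_tail {j : Fin 2} {q : List (Fin (s j + t j + 1) ⊕ Fin (t j))}
    (hq : q ∈ tailZero (s j) (t j)) :
    (twoSpike s t).path K ((q.map (ofTail j)).map (equiv s t)) = 0 :=
  path_eq_zero _ _ (mem_zero.2 (Or.inr ⟨j, q, hq, rfl⟩))

lemma path_triple (x y z : Vert s t) :
    (twoSpike s t).path K ([x, y, z].map (equiv s t)) = arr K x y * arr K y z := by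
  rw [List.map_cons, List.map_cons, List.map_cons, List.map_nil, path_cons_cons, path_cons_cons,
    path_singleton, arrow_mul_idem]
  rfl

lemma val_add_one {j : Fin 2} {x : Fin 6} (hx : (x : ℕ) = 3 * j) :
    ((x + 1 : Fin 6) : ℕ) = (3 * j + 1) % 6 := by
  rw [Fin.val_add, hx]; rfl

lemma cycle_mul_spike {j : Fin 2} {x y : Fin 6} (hx : (x : ℕ) = 3 * j) (hy : y = x + 1) :
    arr K (s := s) (t := t) (Sum.inl x) (Sum.inl y) *
      arr K (Sum.inl y) (Sum.inr ⟨j, Sum.inl 0⟩) = 0 := by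
  subst hy
  rw [← path_triple]
  exact path_map_eq_zero_of_skel K (q := [Sum.inl x, Sum.inl (x + 1), Sum.inr j])
    (Or.inl ⟨j, x, x + 1, hx, val_add_one hx, Or.inl rfl⟩)

lemma spike_mul_cycle {j : Fin 2} {x y : Fin 6} (hx : (x : ℕ) = 3 * j) (hy : y = x + 1) :
    arr K (s := s) (t := t) (Sum.inr ⟨j, Sum.inl 0⟩) (Sum.inl x) *
      arr K (Sum.inl x) (Sum.inl y) = 0 := by
  subst hy
  rw [← path_triple]
  exact path_map_eq_zero_of_skel K (q := [Sum.inr j, Sum.inl x, Sum.inl (x + 1)])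
    (Or.inl ⟨j, x, x + 1, hx, val_add_one hx, Or.inr rfl⟩)

lemma path_centralPath (x : Fin 6) : (twoSpike s t).path K
    ((((centralPath x).map Sum.inl).map ofSkeleton).map (equiv s t)) =
      walk K (cyc s t (x + 1)) 5 := by
  have h : ∀ k : ℕ, k < 6 → cyc s t (x + 1) k = Sum.inl (x + Fin.ofNat 6 (k + 1)) := fun k hk => by
    refine congrArg Sum.inl ?_
    interval_cases k <;> revert x <;> decide
  simp only [walk, h 0 (by decide), h 1 (by decide), h 2 (by decide), h 3 (by decide),
    h 4 (by decide), h 5 (by decide)]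
  rw [e_mul_arr, centralPath_six, (by decide : ∀ x : Fin 6, x + Fin.ofNat 6 (5 + 1) = x) x]
  simp only [List.map_cons, List.map_nil, path_cons_cons, path_singleton, arrow_mul_idem]
  simp only [mul_assoc]
  rfl

/-- The walk ends at `a - 1`, and the arrow from `a - 1` to `a` carries a spike only for `a = 1` and
`a = 4`. Otherwise the long path is one of the zero relations. -/
lemma walk_cyc_eq_zero {a : Fin 6} (h1 : a ≠ 1) (h4 : a ≠ 4) : walk K (cyc s t a) 5 = 0 := by
  have := path_centralPath (s := s) (t := t) K (a - 1)
  rw [sub_add_cancel] at this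
  rw [← this]
  refine path_map_eq_zero_of_skel K (Or.inr ⟨a - 1, ?_, rfl⟩)
  clear this
  revert a
  change ∀ a : Fin 6, a ≠ 1 → a ≠ 4 → ∀ j : Fin 2, ((a - 1 : Fin 6) : ℕ) ≠ 3 * j
  decide

lemma walk_cyc_eq {j : Fin 2} {x a : Fin 6} (hx : (x : ℕ) = 3 * j) (ha : a = x + 1) :
    walk K (cyc s t a) 5 = arr K (Sum.inl a) (Sum.inr ⟨j, Sum.inl 0⟩) *
      arr K (Sum.inr ⟨j, Sum.inl 0⟩) (Sum.inl x) := by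
  subst ha
  rw [← path_triple, ← path_centralPath]
  exact (path_eq_path _ _ (mem_comm.2 ⟨([Sum.inl (x + 1), Sum.inr j, Sum.inl x], _),
    ⟨j, x, x + 1, hx, val_add_one hx, rfl⟩, rfl⟩)).symm

variable {j : Fin 2} {p : Fin (t j)} {q q' : Fin (s j + t j + 1)}

lemma lin_mul_up (hq : (q : ℕ) = s j + p) (hq' : (q' : ℕ) = s j + p + 1) :
    arr K (s := s) (t := t) (Sum.inr ⟨j, Sum.inl q⟩) (Sum.inr ⟨j, Sum.inl q'⟩) *
      arr K (Sum.inr ⟨j, Sum.inl q'⟩) (Sum.inr ⟨j, Sum.inr p⟩) = 0 := by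
  rw [← path_triple]
  exact path_map_eq_zero_of_tail K (q := [Sum.inl q, Sum.inl q', Sum.inr p])
    ⟨p, q, q', hq, hq', Or.inl rfl⟩

lemma up_mul_down (hq : (q : ℕ) = s j + p) (hq' : (q' : ℕ) = s j + p + 1) :
    arr K (s := s) (t := t) (Sum.inr ⟨j, Sum.inl q'⟩) (Sum.inr ⟨j, Sum.inr p⟩) *
      arr K (Sum.inr ⟨j, Sum.inr p⟩) (Sum.inr ⟨j, Sum.inl q⟩) = 0 := by
  rw [← path_triple]
  exact path_map_eq_zero_of_tail K (q := [Sum.inl q', Sum.inr p, Sum.inl q])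
    ⟨p, q, q', hq, hq', Or.inr (Or.inl rfl)⟩

lemma down_mul_lin (hq : (q : ℕ) = s j + p) (hq' : (q' : ℕ) = s j + p + 1) :
    arr K (s := s) (t := t) (Sum.inr ⟨j, Sum.inr p⟩) (Sum.inr ⟨j, Sum.inl q⟩) *
      arr K (Sum.inr ⟨j, Sum.inl q⟩) (Sum.inr ⟨j, Sum.inl q'⟩) = 0 := by
  rw [← path_triple]
  exact path_map_eq_zero_of_tail K (q := [Sum.inr p, Sum.inl q, Sum.inl q'])
    ⟨p, q, q', hq, hq', Or.inr (Or.inr rfl)⟩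

end Relations

/-- The path from one vertex to another whose class is not zero, if there is one. -/
noncomputable def bas : Vert s t → Vert s t → (twoSpike s t).Alg K
  | Sum.inl a, Sum.inl x => walk K (cyc s t a) (x - a).val
  | Sum.inl a, Sum.inr ⟨j, Sum.inl q⟩ =>
      arr K (Sum.inl a) (Sum.inr ⟨j, Sum.inl 0⟩) * walk K (lin s t j) q
  | Sum.inl _, Sum.inr ⟨_, Sum.inr _⟩ => 0
  | Sum.inr ⟨j, Sum.inl q⟩, Sum.inl x => arr K (Sum.inr ⟨j, Sum.inl q⟩) (Sum.inl x)
  | Sum.inr ⟨j, Sum.inl q⟩, Sum.inr ⟨_, Sum.inl q'⟩ =>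
      walk K (fun k => lin s t j (q + k)) (q' - q)
  | Sum.inr ⟨j, Sum.inl q⟩, Sum.inr ⟨k, Sum.inr p⟩ =>
      arr K (Sum.inr ⟨j, Sum.inl q⟩) (Sum.inr ⟨k, Sum.inr p⟩)
  | Sum.inr ⟨j, Sum.inr p⟩, Sum.inl x =>
      arr K (Sum.inr ⟨j, Sum.inr p⟩) (Sum.inr ⟨j, Sum.inl 0⟩) *
        arr K (Sum.inr ⟨j, Sum.inl 0⟩) (Sum.inl x)
  | Sum.inr ⟨j, Sum.inr p⟩, Sum.inr ⟨k, Sum.inl q⟩ =>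
      arr K (Sum.inr ⟨j, Sum.inr p⟩) (Sum.inr ⟨k, Sum.inl q⟩)
  | Sum.inr ⟨j, Sum.inr p⟩, Sum.inr ⟨k, Sum.inr p'⟩ =>
      if j = k ∧ (p : ℕ) = p' then e K (Sum.inr ⟨j, Sum.inr p⟩) else
        arr K (Sum.inr ⟨j, Sum.inr p⟩) (lin s t j (s j + p)) *
          arr K (lin s t j (s j + p)) (Sum.inr ⟨k, Sum.inr p'⟩)

lemma bas_self (i : Vert s t) : bas K i i = e K i := by
  rcases i with a | ⟨j, q | p⟩ <;> simp [bas, cyc, lin]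

/-- Reachability is needed: between two linear vertices `bas` ignores the tail of the second one and
uses a truncated difference, so its value is meaningful only on `Reach`. -/
lemma bas_mul_e {i j : Vert s t} (h : Reach i j) : bas K i j * e K j = bas K i j := by
  rcases i with a | ⟨i, q₀ | p₀⟩ <;> rcases j with x | ⟨j, q | p⟩ <;> simp only [bas]
  · conv_lhs => rw [← cyc_sub (s := s) (t := t) a x]
    exact walk_mul_e K _ _
  · rw [mul_assoc, ← lin_val j q, walk_mul_e]
  · exact h.elim
  · simp
  · obtain ⟨rfl, h⟩ := h
    rw [← lin_val i q]
    have := walk_mul_e K (fun k => lin s t i (q₀ + k)) (q - q₀)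
    simpa only [Nat.add_sub_of_le h] using this
  · simp
  · rw [mul_assoc, arr_mul_e]
  · simp
  · obtain ⟨rfl, h⟩ := h
    split_ifs with h'
    · rw [Fin.ext h'.2, e_mul_e]
    · rw [mul_assoc, arr_mul_e]

/-- Prolonging a nonzero path by an arrow either gives the next chosen path or runs into a relation.
This matches the algebra with the combinatorial relation `Step`, case by case. -/
lemma bas_mul_arr {i j k : Vert s t} (h : Reach i j) (h' : Adj j k) :
    (Step i j k ∧ bas K i j * arr K j k = bas K i k) ∨
      (¬ Step i j k ∧ bas K i j * arr K j k = 0) := by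
  rcases i with a | ⟨i, q₀ | p₀⟩
  · rcases j with x | ⟨j, q | p⟩
    · rcases k with y | ⟨k, q' | p'⟩ <;> simp only [Adj] at h' <;> simp only [bas, Reach] at h ⊢
      · subst h'
        -- The path already has length five. Replacing it by the path through the spike makes its
        -- last arrow compose to zero with the next arrow of the cycle.
        by_cases h5 : x = a + 5
        · obtain ⟨j, hj⟩ : ∃ j : Fin 2, (x : ℕ) = 3 * j := by
            obtain rfl | rfl := h h5
            · exact ⟨0, by rw [h5]; rfl⟩
            · exact ⟨1, by rw [h5]; rfl⟩
          have ha : a = x + 1 := by rw [h5]; exact (by decide : ∀ a : Fin 6, a = a + 5 + 1) a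
          refine Or.inr ⟨(fun h' => h'.2.1 h5), ?_⟩
          rw [show (x - a).val = 5 by
            rw [h5]; exact (by decide : ∀ a : Fin 6, (a + 5 - a).val = 5) a,
            walk_cyc_eq K hj ha, mul_assoc, spike_mul_cycle K hj rfl, mul_zero]
        · have hv : (x + 1 - a).val = (x - a).val + 1 := by
            clear h; revert x a; decide
          have hw : walk K (cyc s t a) (x - a).val * arr K (Sum.inl x) (Sum.inl (x + 1)) =
              walk K (cyc s t a) (x + 1 - a).val := by
            have h1 := cyc_sub (s := s) (t := t) a (x + 1)
            rw [hv] at h1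
            rw [hv, walk_succ, cyc_sub, h1]
          rw [hw]
          by_cases h6 : x = a + 4 → a = 1 ∨ a = 4
          · exact Or.inl ⟨⟨rfl, h5, h6⟩, rfl⟩
          · have h4 : x = a + 4 ∧ a ≠ 1 ∧ a ≠ 4 := by tauto
            obtain ⟨rfl, h4⟩ := h4
            refine Or.inr ⟨fun h => h6 h.2.2, ?_⟩
            rw [(by decide : ∀ a : Fin 6, (a + 4 + 1 - a).val = 5) a]
            exact walk_cyc_eq_zero K h4.1 h4.2
      · obtain ⟨h1, h2⟩ := h'
        obtain rfl : q' = 0 := Fin.ext h2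
        by_cases hx : a = x
        · subst hx
          refine Or.inl ⟨⟨rfl, h1, rfl⟩, ?_⟩
          simp [cyc, lin]
        -- A path that does not start at `x` arrives there from `x - 1`, along the spiked arrow, and
        -- cannot be continued into the spike.
        · refine Or.inr ⟨(fun h => hx h.1), ?_⟩
          have hv : (x - a).val = (x - 1 - a).val + 1 := by
            clear h h1; revert x a; decide
          have h3 := cyc_sub (s := s) (t := t) a x
          rw [hv] at h3
          rw [hv, walk_succ, cyc_sub, h3, mul_assoc, cycle_mul_spike K (j := k) ?_
            (sub_add_cancel x 1).symm, mul_zero]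
          rw [Fin.sub_val_of_le (Fin.le_def.2 (by rw [h1]; exact Nat.le_add_left 1 _)), h1]
          rfl
    · have ha : (a : ℕ) = 3 * j + 1 := h
      rcases k with y | ⟨k, q' | p'⟩ <;> simp only [Adj] at h' <;> simp only [bas]
      · obtain ⟨h1, h2⟩ := h'
        obtain rfl : q = 0 := Fin.ext h2
        have ha' : a = y + 1 := Fin.ext (by rw [val_add_one h1]; omega)
        refine Or.inl ⟨⟨ha, h1, rfl⟩, ?_⟩
        rw [show (y - a).val = 5 by
            rw [ha']; exact (by decide : ∀ y : Fin 6, (y - (y + 1)).val = 5) y,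
          walk_cyc_eq K h1 ha']
        simp [lin]
      · obtain ⟨rfl, h2⟩ := h'
        refine Or.inl ⟨⟨ha, rfl, h2⟩, ?_⟩
        rw [h2, walk_succ, ← h2, lin_val, lin_val, mul_assoc]
      · obtain ⟨rfl, h2⟩ := h'
        have h3 := lin_mul_up K (p := p') (q := ⟨s j + p', by omega⟩) rfl h2
        refine Or.inr ⟨not_false, ?_⟩
        rw [h2, walk_succ, ← h2, lin_val,
          show lin s t j (s j + p') = _ from lin_val j ⟨s j + p', by omega⟩, mul_assoc, mul_assoc,
          h3, mul_zero, mul_zero]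
    · exact h.elim
  · rcases j with x | ⟨j, q | p⟩
    · obtain ⟨h1, h2⟩ := h
      obtain rfl : q₀ = 0 := Fin.ext h2
      rcases k with y | ⟨k, q' | p'⟩ <;> simp only [Adj] at h' <;> simp only [bas]
      · refine Or.inr ⟨not_false, ?_⟩
        rw [spike_mul_cycle K h1 h']
      · omega
    · obtain ⟨rfl, hq⟩ := h
      rcases k with y | ⟨k, q' | p'⟩ <;> simp only [Adj] at h' <;> simp only [bas]
      · obtain ⟨h1, h2⟩ := h'
        obtain rfl : q = 0 := Fin.ext h2
        obtain rfl : q₀ = 0 := Fin.ext (Nat.le_zero.1 hq)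
        refine Or.inl ⟨⟨rfl, rfl, h1, rfl⟩, ?_⟩
        simp [lin]
      · obtain ⟨rfl, h2⟩ := h'
        refine Or.inl ⟨⟨rfl, hq, rfl, h2⟩, ?_⟩
        rw [show (q' : ℕ) - q₀ = (q - q₀) + 1 by omega, walk_succ, Nat.add_sub_of_le hq,
          show (q₀ : ℕ) + (q - q₀ + 1) = q' by omega, lin_val, lin_val]
      · obtain ⟨rfl, h2⟩ := h'
        by_cases hq' : (q₀ : ℕ) = q
        · obtain rfl := Fin.ext hq'
          refine Or.inl ⟨⟨rfl, rfl, rfl, h2⟩, ?_⟩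
          simp [lin]
        · refine Or.inr ⟨(fun h => hq' h.2.1), ?_⟩
          -- The last arrow of the path lies in the same triangle as the arrow to the apex, so their
          -- product vanishes.
          have h3 := lin_mul_up K (p := p') (q := ⟨s i + p', by omega⟩) rfl h2
          rw [show (q : ℕ) - q₀ = (s i + p' - q₀) + 1 by omega, walk_succ,
            show (q₀ : ℕ) + (s i + p' - q₀) = s i + p' by omega,
            show (q₀ : ℕ) + (s i + p' - q₀ + 1) = q by omega, lin_val,
            show lin s t i (s i + p') = _ from lin_val i ⟨s i + p', by omega⟩, mul_assoc, h3,
            mul_zero]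
    · obtain ⟨rfl, hq⟩ := h
      rcases k with y | ⟨k, q' | p'⟩ <;> simp only [Adj] at h'
      obtain ⟨rfl, h2⟩ := h'
      simp only [bas]
      refine Or.inr ⟨not_false, ?_⟩
      rw [up_mul_down K h2 hq]
  · rcases j with x | ⟨j, q | p⟩
    · obtain ⟨h1, h2⟩ := h
      rcases k with y | ⟨k, q' | p'⟩ <;> simp only [Adj] at h' <;> simp only [bas]
      · refine Or.inr ⟨not_false, ?_⟩
        rw [mul_assoc, spike_mul_cycle K h1 h', mul_zero]
      · omega
    · obtain ⟨rfl, hq⟩ := h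
      rcases k with y | ⟨k, q' | p'⟩ <;> simp only [Adj] at h' <;> simp only [bas]
      · obtain ⟨h1, h2⟩ := h'
        obtain rfl : q = 0 := Fin.ext h2
        exact Or.inl ⟨⟨rfl, hq.symm, h1, rfl⟩, rfl⟩
      · obtain ⟨rfl, h2⟩ := h'
        refine Or.inr ⟨not_false, ?_⟩
        rw [down_mul_lin K hq (by omega)]
      · obtain ⟨rfl, h2⟩ := h'
        refine Or.inl ⟨⟨rfl, by omega, rfl, h2⟩, ?_⟩
        rw [if_neg (by omega), ← hq, lin_val]
    · obtain ⟨rfl, hp⟩ := h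
      rcases k with y | ⟨k, q' | p'⟩ <;> simp only [Adj] at h'
      obtain ⟨rfl, h2⟩ := h'
      simp only [bas]
      by_cases hp' : (p₀ : ℕ) = p
      · obtain rfl := Fin.ext hp'
        refine Or.inl ⟨⟨rfl, rfl, rfl, h2⟩, ?_⟩
        rw [if_pos ⟨trivial, rfl⟩, e_mul_arr]
      · refine Or.inr ⟨(fun h => hp' h.2.1), ?_⟩
        rw [if_neg (fun h => hp' h.2), mul_assoc,
          show lin s t i (s i + p₀) = _ from lin_val i ⟨s i + p₀, by omega⟩,
          up_mul_down K h2 (by simp only; omega), mul_zero]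

open Classical in
/-- A Peirce basis of the algebra of `twoSpike s t`. -/
noncomputable def peirceBasis (s t : Fin 2 → ℕ) : (twoSpike s t).PeirceBasis K :=
  PeirceBasis.ofEquiv (equiv s t) Step isRep_step (fun i j => if Reach i j then bas K i j else 0)
    (fun i => by rw [if_pos (reach_self i), bas_self]; rfl)
    (fun i j => by
      split_ifs with h
      · exact bas_mul_e K h
      · exact zero_mul _)
    Reach reflTransGen_step_iff
    (fun i j k h h' => by
      rw [if_pos h, if_pos (h.step h')]
      exact ((bas_mul_arr K h h'.adj).resolve_right fun h => h.1 h').2)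
    (fun i j k h h' => by
      rw [if_pos h]
      by_cases hA : Adj j k
      · exact ((bas_mul_arr K h hA).resolve_left fun h => h' h.1).2
      · exact (congrArg _ (arr_eq_zero K hA)).trans (mul_zero _))
    (fun i j h => if_neg h)

lemma finite_alg (s t : Fin 2 → ℕ) : Module.Finite K ((twoSpike s t).Alg K) :=
  (peirceBasis K s t).finite

open Classical in
theorem cartan_equiv (x y : Vert s t) : (twoSpike s t).cartan K (equiv s t x) (equiv s t y) =
    if Reach x y then 1 else 0 := by
  rw [(peirceBasis K s t).cartan_apply]
  exact if_congr (PeirceBasis.ofEquiv_R _ x y) rfl rfl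

end TwoSpike
end BoundQuiver

/-! ### Mutations of sums of arrows -/

section Mutation

variable {V : Type*} [DecidableEq V]

/-- Mutation equivalence of skew-symmetric matrices. -/
abbrev Mut (B B' : Matrix V V ℤ) : Prop :=
  Relation.ReflTransGen (fun B B' : Matrix V V ℤ => ∃ k, B' = mutate k B) B B'

lemma reindex_mutate {W : Type*} [DecidableEq W] (e : V ≃ W) (k : V) (B : Matrix V V ℤ) :
    Matrix.reindex e e (mutate k B) = mutate (e k) (Matrix.reindex e e B) := by
  ext i j
  simp [mutate, Equiv.symm_apply_eq]

lemma Mut.reindex {W : Type*} [DecidableEq W] (e : V ≃ W) {B B' : Matrix V V ℤ} (h : Mut B B') :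
    Mut (Matrix.reindex e e B) (Matrix.reindex e e B') :=
  h.lift _ fun _ _ ⟨k, hk⟩ => ⟨e k, by rw [hk, reindex_mutate]⟩

/-- The skew-symmetric matrix of a single arrow. -/
def edge (a b : V) : Matrix V V ℤ := Matrix.single a b 1 - Matrix.single b a 1

/-- The skew-symmetric matrix of the arrows from every element of a list to the next one. -/
def line : List V → Matrix V V ℤ
  | [] => 0
  | [_] => 0
  | a :: b :: l => edge a b + line (b :: l)

@[simp] lemma line_singleton (a : V) : line [a] = 0 := rfl

@[simp] lemma line_cons_cons (a b : V) (l : List V) :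
    line (a :: b :: l) = edge a b + line (b :: l) := rfl

/-- No arrow starts or ends at `k`. -/
def Isolated (B : Matrix V V ℤ) (k : V) : Prop := ∀ i, B i k = 0 ∧ B k i = 0

omit [DecidableEq V] in
lemma Isolated.add {B B' : Matrix V V ℤ} {k : V} (h : Isolated B k) (h' : Isolated B' k) :
    Isolated (B + B') k := fun i => by
  simp [(h i).1, (h i).2, (h' i).1, (h' i).2]

omit [DecidableEq V] in
lemma isolated_zero (k : V) : Isolated (0 : Matrix V V ℤ) k := fun _ => ⟨rfl, rfl⟩

lemma isolated_edge {a b k : V} (ha : a ≠ k) (hb : b ≠ k) : Isolated (edge a b) k := fun i => by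
  simp [edge, ha, hb]

lemma isolated_line {l : List V} {k : V} (h : k ∉ l) : Isolated (line l) k := by
  induction l using line.induct with
  | case1 => exact isolated_zero k
  | case2 a => exact isolated_zero k
  | case3 a b l ih =>
    simp only [List.mem_cons, not_or] at h ih
    exact (isolated_edge (Ne.symm h.1) (Ne.symm h.2.1)).add (ih h.2)

omit [DecidableEq V] in
lemma isolated_sum {ι : Type*} {S : Finset ι} {B : ι → Matrix V V ℤ} {k : V}
    (h : ∀ i ∈ S, Isolated (B i) k) : Isolated (∑ i ∈ S, B i) k := by
  classical
  induction S using Finset.induction_on with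
  | empty => exact isolated_zero k
  | insert i S hi ih =>
    rw [Finset.sum_insert hi]
    exact (h i (Finset.mem_insert_self _ _)).add
      (ih fun j hj => h j (Finset.mem_insert_of_mem hj))

lemma edge_apply (a b i j : V) : edge a b i j =
    (if a = i then 1 else 0) * (if j = b then 1 else 0) -
      (if a = j then 1 else 0) * (if i = b then 1 else 0) := by
  simp only [edge, Matrix.sub_apply, Matrix.single_apply, eq_comm (a := b), ite_and]
  split_ifs <;> rfl

lemma sum_edge_left_apply (l : List V) (k i j : V) :
    (l.map fun a => edge a k).sum i j =
      (l.count i : ℤ) * (if j = k then 1 else 0) - (l.count j : ℤ) * (if i = k then 1 else 0) := by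
  induction l with
  | nil => simp
  | cons a l ih =>
    rw [List.map_cons, List.sum_cons, Matrix.add_apply, ih]
    rw [edge_apply, List.count_cons, List.count_cons]
    simp only [beq_iff_eq]
    push_cast
    ring

lemma edge_swap (a b : V) : edge b a = -edge a b := by simp [edge]

lemma sum_edge_right (l : List V) (k : V) :
    (l.map fun b => edge k b).sum = -(l.map fun a => edge a k).sum := by
  induction l with
  | nil => simp
  | cons a l ih => simp only [List.map_cons, List.sum_cons, ih, edge_swap a k]; abel

lemma sum_edge_apply (l l' : List V) (i j : V) :
    (l.map fun a => (l'.map fun b => edge a b).sum).sum i j =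
      (l.count i : ℤ) * l'.count j - (l.count j : ℤ) * l'.count i := by
  induction l' with
  | nil => simp
  | cons b l' ih =>
    simp only [List.map_cons, List.sum_cons, List.sum_map_add, Matrix.add_apply, ih,
      sum_edge_left_apply, List.count_cons, beq_iff_eq, eq_comm (a := b)]
    push_cast
    ring

/-- Mutation at a vertex with the in-neighbours `l` and the out-neighbours `l'`. -/
lemma mutate_eq {k : V} {R : Matrix V V ℤ} (hR : Isolated R k) (l l' : List V) (hl : k ∉ l)
    (hl' : k ∉ l') (hd : ∀ a ∈ l, a ∉ l') :
    mutate k (R + (l.map fun a => edge a k).sum + (l'.map fun b => edge k b).sum) =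
      R + (l.map fun a => edge k a).sum + (l'.map fun b => edge b k).sum +
        (l.map fun a => (l'.map fun b => edge a b).sum).sum := by
  -- As no vertex is both an in- and an out-neighbour, one of the two counts vanishes and positive
  -- parts are again counts.
  have hc : ∀ i, max ((l.count i : ℤ) - l'.count i) 0 = l.count i ∧
      max ((l'.count i : ℤ) - l.count i) 0 = l'.count i := fun i => by
    by_cases h : i ∈ l
    · rw [List.count_eq_zero_of_not_mem (hd i h)]; simp
    · rw [List.count_eq_zero_of_not_mem h]; simp
  have hk : l.count k = 0 := List.count_eq_zero_of_not_mem hl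
  have hk' : l'.count k = 0 := List.count_eq_zero_of_not_mem hl'
  ext i j
  have h1 := hR i
  have h2 := hR j
  have h3 := hR k
  simp only [mutate, Matrix.of_apply, Matrix.add_apply, sum_edge_apply]
  simp only [sum_edge_right, Matrix.neg_apply, sum_edge_left_apply, hk, hk']
  by_cases hi : i = k <;> by_cases hj : j = k
  · subst hi; subst hj; simp [h1.1, hk, hk']
  · subst hi; simp [h2.2, hk, hk', hj]; ring
  · subst hj; simp [h1.1, hk, hk', hi]; ring
  · have a1 := hc i
    have a2 := hc j
    simp only [sub_eq_add_neg] at a1 a2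
    simp only [hi, hj, or_self, if_false, if_true, h1.1, h1.2, h2.1, h2.2, mul_zero, mul_one,
      sub_zero, zero_add, zero_sub, neg_neg, neg_zero, add_zero, Nat.cast_zero, a1.1, a1.2, a2.1, a2.2, add_comm (-(List.count _ l : ℤ))]
    ring

lemma Mut.mutate {k : V} {B B' : Matrix V V ℤ} (R : Matrix V V ℤ) (l l' : List V)
    (hR : Isolated R k) (hl : k ∉ l) (hl' : k ∉ l') (hd : ∀ a ∈ l, a ∉ l')
    (hB : B = R + (l.map fun a => edge a k).sum + (l'.map fun b => edge k b).sum)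
    (hB' : B' = R + (l.map fun a => edge k a).sum + (l'.map fun b => edge b k).sum +
        (l.map fun a => (l'.map fun b => edge a b).sum).sum) : Mut B B' :=
  .single ⟨k, by rw [hB, hB', mutate_eq hR l l' hl hl' hd]⟩

/-- Mutation at one vertex of every triangle in a family. -/
lemma Mut.triangles {ι : Type*} [DecidableEq ι] (w a b : ι → V) (hw : Function.Injective w)
    (hab : ∀ i, a i ≠ b i) (ha : ∀ i j, a i ≠ w j) (hb : ∀ i j, b i ≠ w j) (S : Finset ι)
    (R : Matrix V V ℤ) (hR : ∀ i, i ∈ S → Isolated R (w i)) :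
    Mut (R + ∑ i ∈ S, (edge (a i) (b i) + edge (b i) (w i) + edge (w i) (a i)))
      (R + ∑ i ∈ S, (edge (a i) (w i) + edge (w i) (b i))) := by
  induction S using Finset.induction_on generalizing R with
  | empty => exact .refl
  | insert i S hi ih =>
    rw [Finset.sum_insert hi, Finset.sum_insert hi, ← add_assoc]
    -- The untouched triangle at `i` is absorbed into `R` while the others are opened. Mutation at
    -- `w i` then creates an arrow cancelling the one from `a i` to `b i`.
    refine (ih _ fun j hj => ?_).trans ?_
    · have hij : w i ≠ w j := fun h => hi (hw h ▸ hj)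
      exact (hR j (Finset.mem_insert_of_mem hj)).add (((isolated_edge (ha i j) (hb i j)).add
        (isolated_edge (hb i j) hij)).add (isolated_edge hij (ha i j)))
    · refine Mut.mutate (k := w i) (R + edge (a i) (b i) +
        ∑ i ∈ S, (edge (a i) (w i) + edge (w i) (b i))) [b i] [a i] ?_ (by simp [(hb i i).symm])
        (by simp [(ha i i).symm]) (by simp [(hab i).symm]) ?_ ?_
      · refine ((hR i (Finset.mem_insert_self _ _)).add (isolated_edge (ha i i) (hb i i))).add
          (isolated_sum fun j hj => ?_)
        have hij : w j ≠ w i := fun h => hi (hw h ▸ hj)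
        exact (isolated_edge (ha j i) hij).add (isolated_edge hij (hb j i))
      · simp only [List.map_cons, List.map_nil, List.sum_cons, List.sum_nil]; abel
      · simp only [List.map_cons, List.map_nil, List.sum_cons, List.sum_nil, edge]; abel

/-- Reversal of the first arrow of a linearly ordered branch. -/
lemma Mut.flip (R : Matrix V V ℤ) (u a : V) (q : List V) (hq : (u :: a :: q).Nodup)
    (hR : ∀ k ∈ a :: q, Isolated R k) :
    Mut (R + edge a u + line (a :: q)) (R + line (u :: a :: q)) := by
  induction q generalizing R u a with
  | nil =>
    have hua : u ≠ a := by simpa using hq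
    refine Mut.mutate (k := a) R [] [u] (hR a (by simp)) (by simp) (by simp [hua.symm]) (by simp)
      ?_ ?_ <;> simp
  | cons b q ih =>
    simp only [List.nodup_cons, List.mem_cons, not_or] at hq
    -- Mutation at the source `a` reverses both of its arrows. The one to `u` is now right, and the
    -- wrongly oriented one to `b` is pushed further down the branch.
    refine Relation.ReflTransGen.trans (b := R + edge u a + edge b a + line (b :: q)) ?_ ?_
    · refine Mut.mutate (k := a) (R + line (b :: q)) [] [u, b]
        ((hR a (by simp)).add (isolated_line (by simp [hq]))) (by simp)
        (by simp [hq, Ne.symm hq.1.1]) (by simp) ?_ ?_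
      · simp only [List.map_cons, List.map_nil, List.sum_cons, List.sum_nil, line_cons_cons]; abel
      · simp only [List.map_cons, List.map_nil, List.sum_cons, List.sum_nil]; abel
    · have := ih (R + edge u a) a b (by simp [hq]) fun k hk => (hR k (by simp [hk])).add
        (isolated_edge ?_ ?_)
      · rwa [line_cons_cons u a, ← add_assoc]
      · rintro rfl
        rcases List.mem_cons.1 hk with h | h
        · exact hq.1.2.1 h
        · exact hq.1.2.2 h
      · rintro rfl
        rcases List.mem_cons.1 hk with h | h
        · exact hq.2.1.1 h
        · exact hq.2.1.2 h

/-- Reorientation of a line, keeping the arrows at one of its ends. -/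
lemma Mut.reorient (R : Matrix V V ℤ) (a : V) (r q : List V) (hr : (r ++ a :: q).Nodup)
    (hR : ∀ k, k ∈ (a :: r).dropLast ∨ k ∈ q → Isolated R k) :
    Mut (R + line (a :: r) + line (a :: q)) (R + line (r.reverseAux (a :: q))) := by
  induction r generalizing a q with
  | nil => simpa using Relation.ReflTransGen.refl
  | cons u r ih =>
    have hd : (r.reverse ++ (u :: a :: q)).Nodup := by
      have := List.nodup_append.1 hr
      simp only [List.nodup_append, List.nodup_cons, List.mem_cons, List.nodup_reverse,
        List.mem_reverse, not_or] at this ⊢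
      grind
    have h1 : ∀ k ∈ a :: q, k ∉ u :: r := fun k hk hk' =>
      (List.nodup_append.1 hr).2.2 k hk' k hk rfl
    -- The common source of the two halves moves from `a` to `u`. Repeating this brings it to the
    -- far end of `r`, where no mutation is made.
    refine Relation.ReflTransGen.trans (b := R + line (u :: r) + line (u :: a :: q)) ?_ ?_
    · have := Mut.flip (R + line (u :: r)) u a q (List.nodup_append.1 hd).2.1 fun k hk =>
        (hR k ?_).add (isolated_line (h1 k hk))
      · rw [line_cons_cons a u r]
        convert this using 1
        abel
      · rcases List.mem_cons.1 hk with rfl | hk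
        · exact Or.inl (by simp)
        · exact Or.inr hk
    · refine ih u (a :: q) ?_ fun k hk => hR k ?_
      · simpa [List.nodup_append] using hd
      · rcases hk with hk | hk
        · exact Or.inl (by simp [hk])
        · rcases List.mem_cons.1 hk with rfl | hk
          · exact Or.inl (by simp)
          · exact Or.inr hk

/-- Moving two arrows `c → b`, `d → b` along a linearly ordered branch. -/
lemma Mut.fork (R : Matrix V V ℤ) (c d b y z : V) (ys : List V) (hd : (c :: d :: b :: y :: ys).Nodup)
    (hz : (y :: ys).getLast? = some z) (hR : ∀ k ∈ y :: ys, Isolated R k) :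
    Mut (R + edge b c + edge b d + edge c y + edge d y + edge y b + line (y :: ys))
      (R + edge z c + edge z d + line (b :: y :: ys)) := by
  induction ys generalizing R b y with
  | nil =>
    obtain rfl : y = z := by simpa using hz
    refine Mut.mutate (k := y) (R + edge b c + edge b d) [c, d] [b] ?_ (by grind) (by grind)
      (by grind) ?_ ?_
    · repeat' first | apply isolated_edge | apply Isolated.add
      exacts [hR y (by simp), by grind, by grind, by grind, by grind]
    · simp only [List.map_cons, List.map_nil, List.sum_cons, List.sum_nil, line_singleton]; abel
    · simp only [List.map_cons, List.map_nil, List.sum_cons, List.sum_nil, edge, line]; abel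
  | cons y' ys ih =>
    -- Mutation at `y` cancels the arrows from `b` to `c` and `d` and reproduces the same pair of
    -- triangles one arrow further along the branch.
    refine Relation.ReflTransGen.trans (b := R + edge b y + edge y c + edge y d + edge c y' +
      edge d y' + edge y' y + line (y' :: ys)) ?_ ?_
    · refine Mut.mutate (k := y) (R + edge b c + edge b d + line (y' :: ys)) [c, d] [b, y'] ?_
        (by grind) (by grind) (by grind) ?_ ?_
      · repeat' first | apply isolated_edge | apply isolated_line | apply Isolated.add
        exacts [hR y (by simp), by grind, by grind, by grind, by grind, by grind]
      · simp only [List.map_cons, List.map_nil, List.sum_cons, List.sum_nil, line_cons_cons]; abel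
      · simp only [List.map_cons, List.map_nil, List.sum_cons, List.sum_nil, edge]; abel
    · have := ih (R + edge b y) y y' (by grind) (by simpa using hz) fun k hk =>
        (hR k (by simp [hk])).add (isolated_edge (by grind) (by grind))
      convert this using 1
      rw [line_cons_cons b y]; abel

set_option linter.unusedSimpArgs false in
/-- The quiver consisting of an oriented cycle of length six with two spikes at opposite arrows and of
linearly ordered branches at the spikes is mutation equivalent to a quiver of type `D`. -/
lemma Mut.hexagon (c0 c1 c2 c3 c4 c5 x y z : V) (xs ys : List V)
    (hd : (c0 :: c1 :: c2 :: c3 :: c4 :: c5 :: x :: y :: (xs ++ ys)).Nodup)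
    (hz : (y :: ys).getLast? = some z) :
    Mut (edge c0 c1 + edge c1 c2 + edge c2 c3 + edge c3 c4 + edge c4 c5 + edge c5 c0 + edge c1 x + edge x c0 + edge c4 y + edge y c3 +
        line (x :: xs) + line (y :: ys))
      (edge c3 z + edge c4 z + line ((y :: ys).reverse ++ c1 :: c2 :: c0 :: c5 :: x :: xs)) := by
  have hd' := hd
  simp only [List.nodup_cons, List.mem_cons, List.mem_append, List.nodup_append, not_or] at hd'
  -- Mutations at `c2` and `c5` shorten the central cycle to length four, each leaving a new spike.
  refine Relation.ReflTransGen.trans (b := edge c0 c1 + edge c3 c4 + edge c4 c5 + edge c5 c0 + edge c1 x + edge x c0 + edge c4 y + edge y c3 + edge c1 c3 + edge c2 c1 + edge c3 c2 + line (x :: xs) + line (y :: ys)) ?_ ?_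
  · refine Mut.mutate (k := c2) (edge c0 c1 + edge c3 c4 + edge c4 c5 + edge c5 c0 + edge c1 x + edge x c0 + edge c4 y + edge y c3 + line (x :: xs) + line (y :: ys)) [c1] [c3] ?_
      (by simp only [List.mem_cons, List.not_mem_nil, or_false, not_or]; grind only)
      (by simp only [List.mem_cons, List.not_mem_nil, or_false, not_or]; grind only)
      (by simp only [List.mem_cons, List.not_mem_nil, or_false, not_or, forall_eq, forall_eq_or_imp]; grind only) ?_ ?_
    · repeat' first | apply isolated_edge | apply isolated_line | apply Isolated.add
      all_goals (simp only [List.mem_cons, not_or, ne_eq]; grind only)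
    · simp only [List.map_cons, List.map_nil, List.sum_cons, List.sum_nil]; abel
    · simp only [List.map_cons, List.map_nil, List.sum_cons, List.sum_nil, edge]; abel
  refine Relation.ReflTransGen.trans (b := edge c0 c1 + edge c3 c4 + edge c1 x + edge x c0 + edge c4 y + edge y c3 + edge c1 c3 + edge c2 c1 + edge c3 c2 + edge c4 c0 + edge c5 c4 + edge c0 c5 + line (x :: xs) + line (y :: ys)) ?_ ?_
  · refine Mut.mutate (k := c5) (edge c0 c1 + edge c3 c4 + edge c1 x + edge x c0 + edge c4 y + edge y c3 + edge c1 c3 + edge c2 c1 + edge c3 c2 + line (x :: xs) + line (y :: ys)) [c4] [c0] ?_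
      (by simp only [List.mem_cons, List.not_mem_nil, or_false, not_or]; grind only)
      (by simp only [List.mem_cons, List.not_mem_nil, or_false, not_or]; grind only)
      (by simp only [List.mem_cons, List.not_mem_nil, or_false, not_or, forall_eq, forall_eq_or_imp]; grind only) ?_ ?_
    · repeat' first | apply isolated_edge | apply isolated_line | apply Isolated.add
      all_goals (simp only [List.mem_cons, not_or, ne_eq]; grind only)
    · simp only [List.map_cons, List.map_nil, List.sum_cons, List.sum_nil]; abel
    · simp only [List.map_cons, List.map_nil, List.sum_cons, List.sum_nil, edge]; abel
  -- The mutation at `c0` leaves a central triangle on `c1`, `c3`, `c4`. The one at `c1` then gives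
  -- the 4-cycle through `c1`, `c4`, `y`, `c3`, as in type III.
  refine Relation.ReflTransGen.trans (b := edge c3 c4 + edge c4 y + edge y c3 + edge c1 c3 + edge c2 c1 + edge c3 c2 + edge x c5 + edge c4 c1 + edge c0 x + edge c0 c4 + edge c1 c0 + edge c5 c0 + line (x :: xs) + line (y :: ys)) ?_ ?_
  · refine Mut.mutate (k := c0) (edge c3 c4 + edge c1 x + edge c4 y + edge y c3 + edge c1 c3 + edge c2 c1 + edge c3 c2 + edge c5 c4 + line (x :: xs) + line (y :: ys)) [x, c4] [c1, c5] ?_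
      (by simp only [List.mem_cons, List.not_mem_nil, or_false, not_or]; grind only)
      (by simp only [List.mem_cons, List.not_mem_nil, or_false, not_or]; grind only)
      (by simp only [List.mem_cons, List.not_mem_nil, or_false, not_or, forall_eq, forall_eq_or_imp]; grind only) ?_ ?_
    · repeat' first | apply isolated_edge | apply isolated_line | apply Isolated.add
      all_goals (simp only [List.mem_cons, not_or, ne_eq]; grind only)
    · simp only [List.map_cons, List.map_nil, List.sum_cons, List.sum_nil]; abel
    · simp only [List.map_cons, List.map_nil, List.sum_cons, List.sum_nil, edge]; abel
  refine Relation.ReflTransGen.trans (b := edge c4 y + edge y c3 + edge x c5 + edge c0 x + edge c5 c0 + edge c2 c0 + edge c1 c2 + edge c1 c4 + edge c3 c1 + edge c0 c1 + line (x :: xs) + line (y :: ys)) ?_ ?_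
  · refine Mut.mutate (k := c1) (edge c3 c4 + edge c4 y + edge y c3 + edge c3 c2 + edge x c5 + edge c0 x + edge c0 c4 + edge c5 c0 + line (x :: xs) + line (y :: ys)) [c2, c4] [c3, c0] ?_
      (by simp only [List.mem_cons, List.not_mem_nil, or_false, not_or]; grind only)
      (by simp only [List.mem_cons, List.not_mem_nil, or_false, not_or]; grind only)
      (by simp only [List.mem_cons, List.not_mem_nil, or_false, not_or, forall_eq, forall_eq_or_imp]; grind only) ?_ ?_
    · repeat' first | apply isolated_edge | apply isolated_line | apply Isolated.add
      all_goals (simp only [List.mem_cons, not_or, ne_eq]; grind only)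
    · simp only [List.map_cons, List.map_nil, List.sum_cons, List.sum_nil]; abel
    · simp only [List.map_cons, List.map_nil, List.sum_cons, List.sum_nil, edge]; abel
  -- Type III becomes type II: two triangles share the arrow from `y` to `c1`, which is the
  -- configuration that `Mut.fork` moves.
  refine Relation.ReflTransGen.trans (b := edge c4 y + edge x c5 + edge c0 x + edge c5 c0 + edge c2 c0 + edge c1 c2 + edge c1 c4 + edge c0 c1 + edge y c1 + edge c3 y + edge c1 c3 + line (x :: xs) + line (y :: ys)) ?_ ?_
  · refine Mut.mutate (k := c3) (edge c4 y + edge x c5 + edge c0 x + edge c5 c0 + edge c2 c0 + edge c1 c2 + edge c1 c4 + edge c0 c1 + line (x :: xs) + line (y :: ys)) [y] [c1] ?_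
      (by simp only [List.mem_cons, List.not_mem_nil, or_false, not_or]; grind only)
      (by simp only [List.mem_cons, List.not_mem_nil, or_false, not_or]; grind only)
      (by simp only [List.mem_cons, List.not_mem_nil, or_false, not_or, forall_eq, forall_eq_or_imp]; grind only) ?_ ?_
    · repeat' first | apply isolated_edge | apply isolated_line | apply Isolated.add
      all_goals (simp only [List.mem_cons, not_or, ne_eq]; grind only)
    · simp only [List.map_cons, List.map_nil, List.sum_cons, List.sum_nil]; abel
    · simp only [List.map_cons, List.map_nil, List.sum_cons, List.sum_nil, edge]; abel
  refine Relation.ReflTransGen.trans (b := edge x c5 + edge c0 x + edge c5 c0 + edge c2 c0 + edge c1 c2 + edge c0 c1 + edge z c3 + edge z c4 + line (x :: xs) + line (c1 :: y :: ys)) ?_ ?_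
  · have := Mut.fork (edge x c5 + edge c0 x + edge c5 c0 + edge c2 c0 + edge c1 c2 + edge c0 c1 + line (x :: xs)) c3 c4 c1 y z ys
      (by simp only [List.nodup_cons, List.mem_cons, not_or]; grind only) hz fun k hk => by
      repeat' first | apply isolated_edge | apply isolated_line | apply Isolated.add
      all_goals (simp only [List.mem_cons, not_or, ne_eq] at hk ⊢; grind only)
    convert this using 1 <;> abel
  have hz1 := List.mem_cons.1 (List.mem_of_getLast? hz)
  -- The two remaining triangles are opened at `c2` and `c5`. What is left is a tree.
  refine Relation.ReflTransGen.trans (b := edge x c5 + edge c0 x + edge c5 c0 + edge z c3 + edge z c4 + edge c2 c1 + edge c0 c2 + line (x :: xs) + line (c1 :: y :: ys)) ?_ ?_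
  · refine Mut.mutate (k := c2) (edge x c5 + edge c0 x + edge c5 c0 + edge c0 c1 + edge z c3 + edge z c4 + line (x :: xs) + line (c1 :: y :: ys)) [c1] [c0] ?_
      (by simp only [List.mem_cons, List.not_mem_nil, or_false, not_or]; grind only)
      (by simp only [List.mem_cons, List.not_mem_nil, or_false, not_or]; grind only)
      (by simp only [List.mem_cons, List.not_mem_nil, or_false, not_or, forall_eq, forall_eq_or_imp]; grind only) ?_ ?_
    · repeat' first | apply isolated_edge | apply isolated_line | apply Isolated.add
      all_goals (simp only [List.mem_cons, not_or, ne_eq]; grind only)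
    · simp only [List.map_cons, List.map_nil, List.sum_cons, List.sum_nil]; abel
    · simp only [List.map_cons, List.map_nil, List.sum_cons, List.sum_nil, edge]; abel
  refine Relation.ReflTransGen.trans (b := edge z c3 + edge z c4 + edge c2 c1 + edge c0 c2 + edge c5 x + edge c0 c5 + line (x :: xs) + line (c1 :: y :: ys)) ?_ ?_
  · refine Mut.mutate (k := c5) (edge c0 x + edge z c3 + edge z c4 + edge c2 c1 + edge c0 c2 + line (x :: xs) + line (c1 :: y :: ys)) [x] [c0] ?_
      (by simp only [List.mem_cons, List.not_mem_nil, or_false, not_or]; grind only)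
      (by simp only [List.mem_cons, List.not_mem_nil, or_false, not_or]; grind only)
      (by simp only [List.mem_cons, List.not_mem_nil, or_false, not_or, forall_eq, forall_eq_or_imp]; grind only) ?_ ?_
    · repeat' first | apply isolated_edge | apply isolated_line | apply Isolated.add
      all_goals (simp only [List.mem_cons, not_or, ne_eq]; grind only)
    · simp only [List.map_cons, List.map_nil, List.sum_cons, List.sum_nil]; abel
    · simp only [List.map_cons, List.map_nil, List.sum_cons, List.sum_nil, edge]; abel
  refine Relation.ReflTransGen.trans (b := edge z c4 + edge c2 c1 + edge c0 c2 + edge c5 x + edge c0 c5 + edge c3 z + line (x :: xs) + line (c1 :: y :: ys)) ?_ ?_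
  · refine Mut.mutate (k := c3) (edge z c4 + edge c2 c1 + edge c0 c2 + edge c5 x + edge c0 c5 + line (x :: xs) + line (c1 :: y :: ys)) [z] [] ?_
      (by simp only [List.mem_cons, List.not_mem_nil, or_false, not_or]; grind only)
      (by simp only [List.mem_cons, List.not_mem_nil, or_false, not_or]; grind only)
      (by simp only [List.mem_cons, List.not_mem_nil, or_false, not_or, forall_eq, forall_eq_or_imp]; grind only) ?_ ?_
    · repeat' first | apply isolated_edge | apply isolated_line | apply Isolated.add
      all_goals (simp only [List.mem_cons, not_or, ne_eq]; grind only)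
    · simp only [List.map_cons, List.map_nil, List.sum_cons, List.sum_nil]; abel
    · simp only [List.map_cons, List.map_nil, List.sum_cons, List.sum_nil, edge]; abel
  refine Relation.ReflTransGen.trans (b := edge c2 c1 + edge c0 c2 + edge c5 x + edge c0 c5 + edge c3 z + edge c4 z + line (x :: xs) + line (c1 :: y :: ys)) ?_ ?_
  · refine Mut.mutate (k := c4) (edge c2 c1 + edge c0 c2 + edge c5 x + edge c0 c5 + edge c3 z + line (x :: xs) + line (c1 :: y :: ys)) [z] [] ?_
      (by simp only [List.mem_cons, List.not_mem_nil, or_false, not_or]; grind only)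
      (by simp only [List.mem_cons, List.not_mem_nil, or_false, not_or]; grind only)
      (by simp only [List.mem_cons, List.not_mem_nil, or_false, not_or, forall_eq, forall_eq_or_imp]; grind only) ?_ ?_
    · repeat' first | apply isolated_edge | apply isolated_line | apply Isolated.add
      all_goals (simp only [List.mem_cons, not_or, ne_eq]; grind only)
    · simp only [List.map_cons, List.map_nil, List.sum_cons, List.sum_nil]; abel
    · simp only [List.map_cons, List.map_nil, List.sum_cons, List.sum_nil, edge]; abel
  -- Both halves of the long line start at `c0`. It is reoriented to start at `z` without mutating
  -- at `z`, so the fork there stays intact.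
  have := Mut.reorient (edge c3 z + edge c4 z) c0 (c2 :: c1 :: y :: ys) (c5 :: x :: xs)
    (by simp only [List.nodup_cons, List.nodup_append, List.mem_cons, not_or]; grind only)
    fun k hk => ?_
  · convert this using 1
    · simp only [line_cons_cons]; abel
    · simp [List.reverseAux_eq]
  · have h1 : k ∈ (y :: ys).dropLast → k ∈ y :: ys ∧ k ≠ z := fun h => by
      have h2 := List.dropLast_append_getLast? z hz
      refine ⟨List.mem_of_mem_dropLast h, fun hkz => ?_⟩
      have h3 : ((y :: ys).dropLast ++ [z]).Nodup := by
        rw [h2]; simp only [List.nodup_cons]; grind only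
      exact (List.nodup_append.1 h3).2.2 k h z (by simp) hkz
    simp only [List.dropLast_cons_cons, List.mem_cons] at hk h1
    exact (isolated_edge (by grind only) (by grind only)).add
      (isolated_edge (by grind only) (by grind only))

end Mutation

/-! ### Exchange matrices as sums over arrows, and linear branches -/

section Exchange

variable {V : Type*} [DecidableEq V]

/-- Injectivity of the parametrisation ensures that every arrow is counted exactly once. -/
lemma exchangeMatrix_eq_sum {ι : Type*} [Fintype ι] {A : V → V → Prop} (src tgt : ι → V)
    (hinj : ∀ i j, src i = src j → tgt i = tgt j → i = j)
    (hA : ∀ x y, A x y ↔ ∃ i, src i = x ∧ tgt i = y) :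
    exchangeMatrix A = ∑ i, edge (src i) (tgt i) := by
  classical
  have key : ∀ x y, (∑ i, Matrix.single (src i) (tgt i) (1 : ℤ)) x y = if A x y then 1 else 0 := by
    intro x y
    rw [Matrix.sum_apply]
    simp only [Matrix.single_apply]
    split_ifs with h
    · obtain ⟨i, rfl, rfl⟩ := (hA x y).1 h
      rw [Finset.sum_eq_single i]
      · simp
      · rintro j - hj
        exact if_neg fun h => hj (hinj j i h.1 h.2)
      · simp
    · refine Finset.sum_eq_zero fun i _ => if_neg ?_
      exact fun hi => h ((hA x y).2 ⟨i, hi⟩)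
  ext x y
  have h : ∑ i, edge (src i) (tgt i) = (∑ i, Matrix.single (src i) (tgt i) (1 : ℤ)) -
      (∑ i, Matrix.single (src i) (tgt i) (1 : ℤ))ᵀ := by
    rw [Matrix.transpose_sum, ← Finset.sum_sub_distrib]
    simp [edge]
  rw [h, Matrix.sub_apply, Matrix.transpose_apply, key, key]
  simp [exchangeMatrix]

omit [DecidableEq V] in
lemma reindex_exchangeMatrix {W : Type*} (e : V ≃ W) (A : W → W → Prop) :
    Matrix.reindex e e (exchangeMatrix fun x y => A (e x) (e y)) = exchangeMatrix A := by
  classical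
  ext i j
  refine congrArg₂ (fun a b : ℤ => a - b) (if_congr ?_ rfl rfl) (if_congr ?_ rfl rfl) <;> simp

lemma line_cons_eq_sum (a : V) (l : List V) :
    line (a :: l) = ∑ i : Fin l.length, edge ((a :: l)[(i : ℕ)]) l[(i : ℕ)] := by
  induction l generalizing a with
  | nil => simp
  | cons b l ih =>
    rw [line_cons_cons, ih]
    simp only [List.length_cons]
    rw [Fin.sum_univ_succ]
    simp

/-- The quiver `D_n` along a list of vertices. -/
lemma exists_reindex_eq_dynkinD {n : ℕ} (a b z : V) (l : List V) (hd : (a :: b :: z :: l).Nodup)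
    (hmem : ∀ x, x ∈ a :: b :: z :: l) (hn : (a :: b :: z :: l).length = n) :
    ∃ e : V ≃ Fin n, Matrix.reindex e e (edge a z + edge b z + line (z :: l)) =
      exchangeMatrix (dynkinDArrow n) := by
  subst hn
  let d := a :: b :: z :: l
  let f : Fin d.length ≃ V := hd.getEquivOfForallMemList d hmem
  refine ⟨f.symm, ?_⟩
  -- Every vertex but the last is the source of exactly one arrow. Its target is the next vertex,
  -- except that vertex `0` also points to `2`; hence `max (i + 1) 2`.
  have hsum : exchangeMatrix (fun x y => dynkinDArrow d.length (f.symm x) (f.symm y)) =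
      ∑ i : Fin (l.length + 2), edge (f ⟨i, by simp only [d, List.length_cons]; omega⟩)
        (f ⟨max (i + 1) 2, by simp only [d, List.length_cons]; omega⟩) := by
    refine exchangeMatrix_eq_sum _ _ (fun i j h _ => ?_) fun x y => ?_
    · have := congrArg Fin.val (f.injective h)
      exact Fin.ext this
    · obtain ⟨p, rfl⟩ := f.surjective x
      obtain ⟨q, rfl⟩ := f.surjective y
      simp only [Equiv.symm_apply_apply, f.injective.eq_iff, dynkinDArrow, Fin.ext_iff]
      constructor
      · intro h
        have hq : (q : ℕ) < l.length + 3 := q.2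
        refine ⟨⟨p, by omega⟩, rfl, ?_⟩
        simp only; omega
      · rintro ⟨i, hi, hi'⟩
        omega
  have hB : edge a z + edge b z + line (z :: l) =
      exchangeMatrix (fun x y => dynkinDArrow d.length (f.symm x) (f.symm y)) := by
    rw [hsum, Fin.sum_univ_succ, Fin.sum_univ_succ, line_cons_eq_sum, add_assoc]
    congr 1
  rw [hB]
  exact reindex_exchangeMatrix f.symm (dynkinDArrow d.length)

/-- Transfers absence of repetitions and completeness of the vertex list to the order in which the
resulting `D_n` is read. -/
lemma hexagon_perm (c0 c1 c2 c3 c4 c5 x y z : V) (xs ys l : List V) (hl : y :: ys = l ++ [z]) :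
    (c3 :: c4 :: z :: (l.reverse ++ c1 :: c2 :: c0 :: c5 :: x :: xs)).Perm
      (c0 :: c1 :: c2 :: c3 :: c4 :: c5 :: x :: y :: (xs ++ ys)) := by
  rw [List.perm_iff_count]
  intro u
  have := congrArg (List.count u) hl
  simp only [List.count_cons, List.count_append, List.count_reverse, List.count_nil] at this ⊢
  linarith

section Branch

variable (v w : ℕ → V)

/-- A linear branch `v k → w p → v (k + 1) → w (p + 1) → ...`, without its first vertex. -/
def zigzag : ℕ → ℕ → ℕ → List V
  | _, _, 0 => []
  | k, p, t + 1 => w p :: v (k + 1) :: zigzag (k + 1) (p + 1) t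

/-- A linear branch `v k → v (k + 1) → ... → v (k + s)` followed by a zigzag, without its first
vertex. -/
def branch : ℕ → ℕ → ℕ → List V
  | k, 0, t => zigzag v w k 0 t
  | k, s + 1, t => v (k + 1) :: branch (k + 1) s t

lemma line_zigzag (k p t : ℕ) : line (v k :: zigzag v w k p t) = ∑ i ∈ Finset.range t,
    (edge (v (k + i)) (w (p + i)) + edge (w (p + i)) (v (k + i + 1))) := by
  induction t generalizing k p with
  | zero => simp [zigzag]
  | succ t ih =>
    rw [zigzag, line_cons_cons, line_cons_cons, ih, Finset.sum_range_succ', add_comm]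
    simp only [add_zero, add_assoc, add_comm, add_left_comm]

lemma line_branch (k s t : ℕ) : line (v k :: branch v w k s t) =
    ∑ i ∈ Finset.range s, edge (v (k + i)) (v (k + i + 1)) + ∑ i ∈ Finset.range t,
      (edge (v (k + s + i)) (w i) + edge (w i) (v (k + s + i + 1))) := by
  induction s generalizing k with
  | zero => simp [branch, line_zigzag]
  | succ s ih =>
    rw [branch, line_cons_cons, ih, Finset.sum_range_succ']
    simp only [add_zero, add_assoc, add_comm, add_left_comm]

omit [DecidableEq V] in
lemma length_zigzag (k p t : ℕ) : (zigzag v w k p t).length = 2 * t := by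
  induction t generalizing k p with
  | zero => rfl
  | succ t ih => simp [zigzag, ih]; ring

omit [DecidableEq V] in
lemma length_branch (k s t : ℕ) : (branch v w k s t).length = s + 2 * t := by
  induction s generalizing k with
  | zero => simp [branch, length_zigzag]
  | succ s ih => simp [branch, ih]; ring

omit [DecidableEq V] in
lemma mem_zigzag (k p t i : ℕ) (hi : i < t) :
    w (p + i) ∈ zigzag v w k p t ∧ v (k + i + 1) ∈ zigzag v w k p t := by
  induction t generalizing k p i with
  | zero => omega
  | succ t ih =>
    cases i with
    | zero => simp [zigzag]
    | succ i =>
      have := ih (k + 1) (p + 1) i (by omega)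
      rw [show p + 1 + i = p + (i + 1) by ring, show k + 1 + i + 1 = k + (i + 1) + 1 by ring] at this
      simp [zigzag, this]

omit [DecidableEq V] in
lemma mem_branch_right (k s t i : ℕ) (hi : i < t) : w i ∈ branch v w k s t := by
  induction s generalizing k with
  | zero => simpa [branch] using (mem_zigzag v w k 0 t i hi).1
  | succ s ih => simp [branch, ih]

omit [DecidableEq V] in
lemma mem_branch_left (k s t i : ℕ) (hi : i < s + t) : v (k + i + 1) ∈ branch v w k s t := by
  induction s generalizing k i with
  | zero => exact (mem_zigzag v w k 0 t i (by omega)).2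
  | succ s ih =>
    cases i with
    | zero => simp [branch]
    | succ i =>
      have := ih (k + 1) i (by omega)
      rw [show k + 1 + i + 1 = k + (i + 1) + 1 by ring] at this
      simp [branch, this]

end Branch

end Exchange

/-! ### The two-spike quiver is of mutation type `D` -/

namespace BoundQuiver
namespace TwoSpike

variable (s t : Fin 2 → ℕ)

/-- The vertex of the `p`-th triangle of the `j`-th glued quiver that is not on its linear part. -/
def apex (j : Fin 2) (p : ℕ) : Vert s t :=
  if h : p < t j then Sum.inr ⟨j, Sum.inr ⟨p, h⟩⟩ else Sum.inl 0

lemma apex_val {j : Fin 2} (p : Fin (t j)) : apex s t j p = Sum.inr ⟨j, Sum.inr p⟩ := by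
  simp [apex]

/-- Indices for the arrows of `twoSpike s t`. -/
abbrev ArrowIndex : Type :=
  Fin 6 ⊕ Fin 2 ⊕ Fin 2 ⊕ (Σ j, Fin (s j + t j)) ⊕ (Σ j, Fin (t j)) ⊕ (Σ j, Fin (t j))

/-- The source of an arrow. -/
def src : ArrowIndex s t → Vert s t
  | Sum.inl a => Sum.inl a
  | Sum.inr (Sum.inl j) => Sum.inl (Fin.ofNat 6 (3 * j + 1))
  | Sum.inr (Sum.inr (Sum.inl j)) => Sum.inr ⟨j, Sum.inl 0⟩
  | Sum.inr (Sum.inr (Sum.inr (Sum.inl ⟨j, q⟩))) => Sum.inr ⟨j, Sum.inl ⟨q, by omega⟩⟩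
  | Sum.inr (Sum.inr (Sum.inr (Sum.inr (Sum.inl ⟨j, p⟩)))) =>
      Sum.inr ⟨j, Sum.inl ⟨s j + p + 1, by omega⟩⟩
  | Sum.inr (Sum.inr (Sum.inr (Sum.inr (Sum.inr ⟨j, p⟩)))) => Sum.inr ⟨j, Sum.inr p⟩

/-- The target of an arrow. -/
def tgt : ArrowIndex s t → Vert s t
  | Sum.inl a => Sum.inl (a + 1)
  | Sum.inr (Sum.inl j) => Sum.inr ⟨j, Sum.inl 0⟩
  | Sum.inr (Sum.inr (Sum.inl j)) => Sum.inl (Fin.ofNat 6 (3 * j))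
  | Sum.inr (Sum.inr (Sum.inr (Sum.inl ⟨j, q⟩))) => Sum.inr ⟨j, Sum.inl ⟨q + 1, by omega⟩⟩
  | Sum.inr (Sum.inr (Sum.inr (Sum.inr (Sum.inl ⟨j, p⟩)))) => Sum.inr ⟨j, Sum.inr p⟩
  | Sum.inr (Sum.inr (Sum.inr (Sum.inr (Sum.inr ⟨j, p⟩)))) =>
      Sum.inr ⟨j, Sum.inl ⟨s j + p, by omega⟩⟩

lemma src_tgt_injective (x y : ArrowIndex s t) (h : src s t x = src s t y)
    (h' : tgt s t x = tgt s t y) : x = y := by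
  rcases x with a | j | j | ⟨j, q⟩ | ⟨j, p⟩ | ⟨j, p⟩ <;>
    rcases y with a' | j' | j' | ⟨j', q'⟩ | ⟨j', p'⟩ | ⟨j', p'⟩ <;>
    simp only [src, tgt, Sum.inl.injEq, Sum.inr.injEq, Sigma.mk.injEq, reduceCtorEq] at h h' <;>
    first
    | grind
    | obtain ⟨rfl, h⟩ := h
      obtain ⟨-, h'⟩ := h'
      simp_all [Fin.ext_iff]

lemma adj_iff (x y : Vert s t) : Adj x y ↔ ∃ i, src s t i = x ∧ tgt s t i = y := by
  constructor
  · intro h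
    rcases x with a | ⟨j, q | p⟩ <;> rcases y with b | ⟨k, q' | p'⟩ <;> simp only [Adj] at h
    · exact ⟨Sum.inl a, rfl, by rw [h]; rfl⟩
    · refine ⟨Sum.inr (Sum.inl k), congrArg Sum.inl (Fin.ext ?_), ?_⟩
      · simp only [Fin.val_ofNat]; omega
      · rw [show q' = 0 from Fin.ext h.2]; rfl
    · refine ⟨Sum.inr (Sum.inr (Sum.inl j)), ?_, congrArg Sum.inl (Fin.ext ?_)⟩
      · rw [show q = 0 from Fin.ext h.2]; rfl
      · simp only [Fin.val_ofNat]; omega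
    · obtain ⟨rfl, h⟩ := h
      refine ⟨Sum.inr (Sum.inr (Sum.inr (Sum.inl ⟨j, ⟨q, by omega⟩⟩))), rfl, ?_⟩
      exact congrArg (fun x => (Sum.inr ⟨j, Sum.inl x⟩ : Vert s t))
        (Fin.ext h.symm : (⟨q + 1, by omega⟩ : Fin (s j + t j + 1)) = q')
    · obtain ⟨rfl, h⟩ := h
      refine ⟨Sum.inr (Sum.inr (Sum.inr (Sum.inr (Sum.inl ⟨j, p'⟩)))), ?_, rfl⟩
      rw [show q = ⟨s j + p' + 1, by omega⟩ from Fin.ext h]; rfl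
    · obtain ⟨rfl, h⟩ := h
      refine ⟨Sum.inr (Sum.inr (Sum.inr (Sum.inr (Sum.inr ⟨j, p⟩)))), rfl, ?_⟩
      rw [show q' = ⟨s j + p, by omega⟩ from Fin.ext h]; rfl
  · rintro ⟨a | j | j | ⟨j, q⟩ | ⟨j, p⟩ | ⟨j, p⟩, rfl, rfl⟩ <;> simp only [src, tgt, Adj] <;>
      simp only [Fin.val_ofNat, Fin.val_zero, and_true]
    all_goals omega

lemma not_adj_of_adj {x y : Vert s t} (h : Adj x y) : ¬ Adj y x := by
  rcases x with a | ⟨j, q | p⟩ <;> rcases y with b | ⟨k, q' | p'⟩ <;> simp only [Adj] at h ⊢ <;>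
    try omega
  all_goals
    obtain ⟨rfl, h⟩ := h
    rintro ⟨-, h'⟩
    omega

variable {s t} in
lemma lin_ne {j k : Fin 2} {q : ℕ} {p : Fin (t k)} : lin s t j q ≠ Sum.inr ⟨k, Sum.inr p⟩ := by
  intro h
  obtain ⟨rfl, h⟩ := Sigma.mk.inj (Sum.inr.inj h)
  cases eq_of_heq h

/-- The matrix of `twoSpike s t` after mutation at one vertex of every triangle. -/
lemma mut_exchangeMatrix : Mut (exchangeMatrix (Adj (s := s) (t := t)))
    ((∑ a : Fin 6, edge (Sum.inl a) (Sum.inl (a + 1))) + edge (Sum.inl 1) (lin s t 0 0) +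
      edge (lin s t 0 0) (Sum.inl 0) + edge (Sum.inl 4) (lin s t 1 0) +
      edge (lin s t 1 0) (Sum.inl 3) +
      line (lin s t 0 0 :: branch (lin s t 0) (apex s t 0) 0 (s 0) (t 0)) +
      line (lin s t 1 0 :: branch (lin s t 1) (apex s t 1) 0 (s 1) (t 1))) := by
  have hlin : ∀ (j : Fin 2) (q : ℕ) (h : q < s j + t j + 1),
      lin s t j q = Sum.inr ⟨j, Sum.inl ⟨q, h⟩⟩ := fun j q h => lin_val j ⟨q, h⟩
  have h := Mut.triangles (ι := Σ j, Fin (t j)) (V := Vert s t) (fun i => Sum.inr ⟨i.1, Sum.inr i.2⟩)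
    (fun i => lin s t i.1 (s i.1 + i.2)) (fun i => lin s t i.1 (s i.1 + i.2 + 1))
    (fun i j h => by
      obtain ⟨i, p⟩ := i
      obtain ⟨j, q⟩ := j
      obtain ⟨rfl, h⟩ := Sigma.mk.inj (Sum.inr.inj h)
      cases eq_of_heq h
      rfl)
    (fun i => by
      rw [hlin _ _ (by omega), hlin _ _ (by omega)]
      simp)
    (fun i j => lin_ne) (fun i j => lin_ne) Finset.univ
    ((∑ a : Fin 6, edge (Sum.inl a) (Sum.inl (a + 1))) + edge (Sum.inl 1) (lin s t 0 0) +
      edge (lin s t 0 0) (Sum.inl 0) + edge (Sum.inl 4) (lin s t 1 0) +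
      edge (lin s t 1 0) (Sum.inl 3) +
      ∑ i ∈ Finset.range (s 0), edge (lin s t 0 i) (lin s t 0 (i + 1)) +
      ∑ i ∈ Finset.range (s 1), edge (lin s t 1 i) (lin s t 1 (i + 1)))
    (fun i _ => by
      repeat' first
        | apply isolated_edge
        | refine isolated_sum fun _ _ => ?_
        | apply Isolated.add
      all_goals first | exact Sum.inl_ne_inr | exact lin_ne)
  convert h using 1
  · rw [exchangeMatrix_eq_sum (src s t) (tgt s t) (src_tgt_injective s t) (adj_iff s t)]
    -- The first `s j` arrows of the linear part are lines and stay in `R`; the last `t j` are sides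
    -- of triangles.
    have hs : ∀ j : Fin 2, ∑ q : Fin (s j + t j), edge (lin s t j q) (lin s t j (q + 1)) =
        ∑ q ∈ Finset.range (s j), edge (lin s t j q) (lin s t j (q + 1)) +
          ∑ p : Fin (t j), edge (lin s t j (s j + p)) (lin s t j (s j + p + 1)) := fun j => by
      rw [← Finset.sum_range (fun q => edge (lin s t j q) (lin s t j (q + 1))),
        Finset.sum_range_add,
        Finset.sum_range fun p => edge (lin s t j (s j + p)) (lin s t j (s j + p + 1))]
    simp only [Fintype.sum_sum_type, Fintype.sum_sigma, Fin.sum_univ_two, src, tgt, ← hlin, hs,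
      Fin.val_zero, Finset.sum_add_distrib]
    change _ + (edge (Sum.inl 1) _ + edge (Sum.inl 4) _ + (edge _ (Sum.inl 0) +
      edge _ (Sum.inl 3) + _)) = _
    abel
  · simp only [line_branch, Fintype.sum_sigma, Fin.sum_univ_two, apex_val, zero_add, Finset.sum_range,
      apex_val]
    abel

/-- The quiver of `twoSpike s t` is mutation equivalent to a quiver of type `D`. -/
theorem isMutationEquivalentToD {n : ℕ} (hn : 8 + (s 0 + 2 * t 0) + (s 1 + 2 * t 1) = n) :
    (twoSpike s t).IsMutationEquivalentToD n := by
  classical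
  let xs := branch (lin s t 0) (apex s t 0) 0 (s 0) (t 0)
  let ys := branch (lin s t 1) (apex s t 1) 0 (s 1) (t 1)
  let x := lin s t 0 0
  let y := lin s t 1 0
  let c : Fin 6 → Vert s t := Sum.inl
  have hmem : ∀ u : Vert s t, u ∈ c 0 :: c 1 :: c 2 :: c 3 :: c 4 :: c 5 :: x :: y :: (xs ++ ys) := by
    have hl : ∀ j : Fin 2, ∀ v : Fin (s j + t j + 1) ⊕ Fin (t j), (Sum.inr ⟨j, v⟩ : Vert s t) ∈
        lin s t j 0 :: branch (lin s t j) (apex s t j) 0 (s j) (t j) := by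
      rintro j (q | p)
      · rw [← lin_val j q]
        rcases hq : (q : ℕ) with _ | q'
        · simp
        · have := mem_branch_left (lin s t j) (apex s t j) 0 (s j) (t j) q' (by omega)
          rw [zero_add] at this
          exact List.mem_cons_of_mem _ this
      · rw [← apex_val s t p]
        exact List.mem_cons_of_mem _ (mem_branch_right _ _ 0 _ _ _ p.2)
    rintro (a | ⟨j, v⟩)
    · fin_cases a <;> simp [c]
    · fin_cases j
      · have := List.mem_cons.1 (hl 0 v)
        simp only [List.mem_cons, List.mem_append]
        tauto
      · have := List.mem_cons.1 (hl 1 v)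
        simp only [List.mem_cons, List.mem_append]
        tauto
  have hlen : (c 0 :: c 1 :: c 2 :: c 3 :: c 4 :: c 5 :: x :: y :: (xs ++ ys)).length = n := by
    simp only [List.length_cons, List.length_append, xs, ys, length_branch]
    omega
  have hcard : Fintype.card (Vert s t) = n := by
    simp only [Fintype.card_sum, Fintype.card_sigma, Fintype.card_fin, Fin.sum_univ_two]
    omega
  -- A list that contains all vertices and is no longer than their number has no repetitions.
  have hnd : (c 0 :: c 1 :: c 2 :: c 3 :: c 4 :: c 5 :: x :: y :: (xs ++ ys)).Nodup := by
    rw [← Multiset.coe_nodup, ← Multiset.toFinset_card_eq_card_iff_nodup, Multiset.coe_card, hlen,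
      ← hcard, ← Finset.card_univ]
    congr 1
    ext u
    simpa using hmem u
  obtain ⟨z, hz⟩ : ∃ z, (y :: ys).getLast? = some z := by
    simp [List.getLast?_cons]
  have h1 := mut_exchangeMatrix s t
  have h2 := Mut.hexagon (c 0) (c 1) (c 2) (c 3) (c 4) (c 5) x y z xs ys hnd hz
  obtain ⟨l, hl⟩ : ∃ l, y :: ys = l ++ [z] :=
    ⟨_, (List.dropLast_append_getLast? z hz).symm⟩
  rw [hl, List.reverse_append, List.reverse_singleton, List.singleton_append,
    List.cons_append] at h2
  have hperm := hexagon_perm (c 0) (c 1) (c 2) (c 3) (c 4) (c 5) x y z xs ys l hl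
  obtain ⟨e, he⟩ := exists_reindex_eq_dynkinD (c 3) (c 4) z
    (l.reverse ++ c 1 :: c 2 :: c 0 :: c 5 :: x :: xs) (hperm.nodup_iff.2 hnd)
    (fun u => hperm.mem_iff.2 (hmem u)) (hperm.length_eq.trans hlen)
  refine ⟨fun u v h h' => ?_, (equiv s t).symm.trans e, ?_⟩
  · obtain ⟨u, rfl⟩ := (equiv s t).surjective u
    obtain ⟨v, rfl⟩ := (equiv s t).surjective v
    exact not_adj_of_adj s t ((arrow_iff u v).1 h) ((arrow_iff v u).1 h')
  · rw [Fin.sum_univ_six, show lin s t 1 0 :: _ = l ++ [z] from hl] at h1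
    have h3 := Mut.reindex e (h1.trans h2)
    rw [he] at h3
    convert h3 using 1
    ext i j
    exact congrArg₂ (fun a b : ℤ => a - b) (if_congr (arrow_iff _ _) rfl rfl)
      (if_congr (arrow_iff _ _) rfl rfl)

/-! ### A normal form for the Cartan form -/

section Gram

variable (u : Fin 2 → ℕ) (R : Type) [Fintype R] [DecidableEq R]

/-- Indices for a basis in which the Euler form only depends on few parameters. -/
abbrev GramIndex : Type := Fin 6 ⊕ (Σ j : Fin 2, Fin (u j + 1) ⊕ Unit) ⊕ (R ⊕ R)

/-- The Gram matrix of the Euler form in this basis. -/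
def gram : Matrix (GramIndex u R) (GramIndex u R) ℤ := Matrix.of fun x y => match x, y with
  | Sum.inl a, Sum.inl x => if x = a + 5 → a = 1 ∨ a = 4 then 1 else 0
  | Sum.inl a, Sum.inr (Sum.inl ⟨j, _⟩) => if (a : ℕ) = 3 * j + 1 then 1 else 0
  | Sum.inr (Sum.inl ⟨j, Sum.inl q⟩), Sum.inl x => if (x : ℕ) = 3 * j ∧ (q : ℕ) = 0 then 1 else 0
  | Sum.inr (Sum.inl ⟨j, Sum.inl q⟩), Sum.inr (Sum.inl ⟨k, Sum.inl q'⟩) =>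
      if j = k ∧ (q : ℕ) ≤ q' then 1 else 0
  | Sum.inr (Sum.inl ⟨j, Sum.inl _⟩), Sum.inr (Sum.inl ⟨k, Sum.inr _⟩) => if j = k then 1 else 0
  | Sum.inr (Sum.inl ⟨j, Sum.inr _⟩), Sum.inr (Sum.inl ⟨k, Sum.inl q⟩) =>
      if j = k ∧ (q : ℕ) = u k then -1 else 0
  | Sum.inr (Sum.inl ⟨j, Sum.inr _⟩), Sum.inr (Sum.inl ⟨k, Sum.inr _⟩) => if j = k then 1 else 0
  | Sum.inr (Sum.inr (Sum.inl i)), Sum.inr (Sum.inr (Sum.inr k)) => if i = k then 2 else 0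
  | Sum.inr (Sum.inr (Sum.inr i)), Sum.inr (Sum.inr (Sum.inl k)) => if i = k then -2 else 0
  | _, _ => 0

/-- The bilinear form with Gram matrix `gram u R`. -/
noncomputable def form : LinearMap.BilinForm ℤ (GramIndex u R → ℤ) := Matrix.toBilin' (gram u R)

lemma form_single (x y : GramIndex u R) :
    form u R (Pi.single x 1) (Pi.single y 1) = gram u R x y :=
  Matrix.toBilin'_single _ _ _

end Gram

/-! ### Products of the elementary vectors -/

section Vectors

variable (u r : Fin 2 → ℕ)

/-- The index set of the hyperbolic part. -/
abbrev Hyp : Type := Σ j : Fin 2, Fin (r j)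

/-- The basis vectors of the central cycle. -/
def ctr (a : Fin 6) : GramIndex u (Hyp r) → ℤ := Pi.single (Sum.inl a) 1

/-- The basis vectors of the linear parts. -/
def hvec (j : Fin 2) (q : ℕ) : GramIndex u (Hyp r) → ℤ :=
  if h : q < u j + 1 then Pi.single (Sum.inr (Sum.inl ⟨j, Sum.inl ⟨q, h⟩⟩)) 1 else 0

/-- The basis vectors at the ends of the linear parts. -/
def evec (j : Fin 2) : GramIndex u (Hyp r) → ℤ := Pi.single (Sum.inr (Sum.inl ⟨j, Sum.inr ()⟩)) 1

/-- Partial sums of the first half of a basis of the hyperbolic part. -/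
def fvec (j : Fin 2) (k : ℕ) : GramIndex u (Hyp r) → ℤ :=
  ∑ i : Fin (r j), if (i : ℕ) < k then Pi.single (Sum.inr (Sum.inr (Sum.inl ⟨j, i⟩))) 1 else 0

/-- The second half of a basis of the hyperbolic part. -/
def gvec (j : Fin 2) (i : ℕ) : GramIndex u (Hyp r) → ℤ :=
  if h : i < r j then Pi.single (Sum.inr (Sum.inr (Sum.inr ⟨j, ⟨i, h⟩⟩))) 1 else 0

variable (a x : Fin 6) (j k : Fin 2) (p q : ℕ)

lemma form_ctr_ctr : form u (Hyp r) (ctr u r a) (ctr u r x) =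
    if x = a + 5 → a = 1 ∨ a = 4 then 1 else 0 := form_single _ _ _ _

lemma form_ctr_hvec : form u (Hyp r) (ctr u r a) (hvec u r j q) =
    if (a : ℕ) = 3 * j + 1 ∧ q ≤ u j then 1 else 0 := by
  rw [hvec]
  split_ifs with h1 h2 h2
  · exact (form_single _ _ _ _).trans (if_pos h2.1)
  · exact (form_single _ _ _ _).trans (if_neg (by omega))
  · omega
  · simp

lemma form_ctr_evec : form u (Hyp r) (ctr u r a) (evec u r j) =
    if (a : ℕ) = 3 * j + 1 then 1 else 0 := form_single _ _ _ _

lemma form_hvec_ctr : form u (Hyp r) (hvec u r j q) (ctr u r x) =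
    if (x : ℕ) = 3 * j ∧ q = 0 then 1 else 0 := by
  rw [hvec]
  split_ifs with h1 h2 h2
  · exact (form_single _ _ _ _).trans (if_pos h2)
  · exact (form_single _ _ _ _).trans (if_neg h2)
  · omega
  · simp

lemma form_hvec_hvec : form u (Hyp r) (hvec u r j p) (hvec u r k q) =
    if j = k ∧ p ≤ q ∧ q ≤ u k then 1 else 0 := by
  rw [hvec, hvec]
  split_ifs with h1 h2 h3 h3 h2 h2
  · exact (form_single _ _ _ _).trans (if_pos ⟨h3.1, h3.2.1⟩)
  · exact (form_single _ _ _ _).trans (if_neg fun h => h3 ⟨h.1, h.2, by omega⟩)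
  · omega
  · simp
  · obtain ⟨rfl, h⟩ := h2; omega
  · simp
  · omega
  · simp

lemma form_hvec_evec : form u (Hyp r) (hvec u r j q) (evec u r k) =
    if j = k ∧ q ≤ u j then 1 else 0 := by
  rw [hvec]
  split_ifs with h1 h2 h2
  · exact (form_single _ _ _ _).trans (if_pos h2.1)
  · exact (form_single _ _ _ _).trans (if_neg fun h => h2 ⟨h, by omega⟩)
  · omega
  · simp

lemma form_evec_ctr : form u (Hyp r) (evec u r j) (ctr u r x) = 0 := form_single _ _ _ _

lemma form_evec_hvec : form u (Hyp r) (evec u r j) (hvec u r k q) =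
    if j = k ∧ q = u k then -1 else 0 := by
  rw [hvec]
  split_ifs with h1 h2 h2
  · exact (form_single _ _ _ _).trans (if_pos h2)
  · exact (form_single _ _ _ _).trans (if_neg h2)
  · omega
  · simp

lemma form_evec_evec : form u (Hyp r) (evec u r j) (evec u r k) = if j = k then 1 else 0 :=
  form_single _ _ _ _

lemma form_fvec_left (y : GramIndex u (Hyp r) → ℤ) : form u (Hyp r) (fvec u r j p) y =
    ∑ i : Fin (r j), if (i : ℕ) < p then
      form u (Hyp r) (Pi.single (Sum.inr (Sum.inr (Sum.inl ⟨j, i⟩))) 1) y else 0 := by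
  rw [fvec, map_sum, LinearMap.sum_apply]
  refine Finset.sum_congr rfl fun i _ => ?_
  split_ifs <;> simp

lemma form_fvec_right (y : GramIndex u (Hyp r) → ℤ) : form u (Hyp r) y (fvec u r j p) =
    ∑ i : Fin (r j), if (i : ℕ) < p then
      form u (Hyp r) y (Pi.single (Sum.inr (Sum.inr (Sum.inl ⟨j, i⟩))) 1) else 0 := by
  rw [fvec, map_sum]
  refine Finset.sum_congr rfl fun i _ => ?_
  split_ifs <;> simp

lemma form_ctr_fvec : form u (Hyp r) (ctr u r a) (fvec u r k q) = 0 := by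
  rw [form_fvec_right]
  refine Finset.sum_eq_zero fun i _ => ?_
  rw [ctr, form_single]
  exact ite_self _

lemma form_fvec_ctr : form u (Hyp r) (fvec u r k q) (ctr u r a) = 0 := by
  rw [form_fvec_left]
  refine Finset.sum_eq_zero fun i _ => ?_
  rw [ctr, form_single]
  exact ite_self _

lemma form_hvec_fvec : form u (Hyp r) (hvec u r j p) (fvec u r k q) = 0 := by
  rw [form_fvec_right]
  refine Finset.sum_eq_zero fun i _ => ?_
  rw [hvec]
  split_ifs
  · exact form_single _ _ _ _
  · simp
  · rfl

lemma form_fvec_hvec : form u (Hyp r) (fvec u r k q) (hvec u r j p) = 0 := by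
  rw [form_fvec_left]
  refine Finset.sum_eq_zero fun i _ => ?_
  rw [hvec]
  split_ifs
  · exact form_single _ _ _ _
  · simp
  · rfl

lemma form_evec_fvec : form u (Hyp r) (evec u r j) (fvec u r k q) = 0 := by
  rw [form_fvec_right]
  refine Finset.sum_eq_zero fun i _ => ?_
  rw [evec, form_single]
  exact ite_self _

lemma form_fvec_evec : form u (Hyp r) (fvec u r k q) (evec u r j) = 0 := by
  rw [form_fvec_left]
  refine Finset.sum_eq_zero fun i _ => ?_
  rw [evec, form_single]
  exact ite_self _

lemma form_fvec_fvec : form u (Hyp r) (fvec u r j p) (fvec u r k q) = 0 := by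
  rw [form_fvec_left]
  refine Finset.sum_eq_zero fun i _ => ?_
  rw [form_fvec_right]
  split_ifs
  · refine Finset.sum_eq_zero fun i' _ => ?_
    rw [form_single]
    exact ite_self _
  · rfl

lemma form_fvec_gvec : form u (Hyp r) (fvec u r j p) (gvec u r k q) =
    if j = k ∧ q < p ∧ q < r k then 2 else 0 := by
  rw [form_fvec_left, gvec]
  split_ifs with h1 h2 h2
  · obtain ⟨rfl, h2, h3⟩ := h2
    rw [Finset.sum_eq_single ⟨q, h1⟩]
    · rw [if_pos h2, form_single]
      exact if_pos rfl
    · intro i _ hi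
      rw [form_single]
      refine (ite_congr rfl (fun _ => if_neg fun h => hi ?_) fun _ => rfl).trans (ite_self _)
      simpa using h
    · simp
  · refine Finset.sum_eq_zero fun i _ => ?_
    rw [form_single]
    split_ifs with h3
    · refine if_neg fun h => h2 ?_
      cases h
      exact ⟨rfl, h3, h1⟩
    · rfl
  · omega
  · simp

lemma form_gvec_fvec : form u (Hyp r) (gvec u r k q) (fvec u r j p) =
    if j = k ∧ q < p ∧ q < r k then -2 else 0 := by
  rw [form_fvec_right, gvec]
  split_ifs with h1 h2 h2
  · obtain ⟨rfl, h2, h3⟩ := h2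
    rw [Finset.sum_eq_single ⟨q, h1⟩]
    · rw [if_pos h2, form_single]
      exact if_pos rfl
    · intro i _ hi
      rw [form_single]
      refine (ite_congr rfl (fun _ => if_neg fun h => hi ?_) fun _ => rfl).trans (ite_self _)
      simpa using h.symm
    · simp
  · refine Finset.sum_eq_zero fun i _ => ?_
    rw [form_single]
    split_ifs with h3
    · refine if_neg fun h => h2 ?_
      cases h
      exact ⟨rfl, h3, h1⟩
    · rfl
  · omega
  · simp

lemma form_ctr_gvec : form u (Hyp r) (ctr u r a) (gvec u r k q) = 0 := by
  rw [gvec]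
  split_ifs
  · exact form_single _ _ _ _
  · simp

lemma form_gvec_ctr : form u (Hyp r) (gvec u r k q) (ctr u r a) = 0 := by
  rw [gvec]
  split_ifs
  · exact form_single _ _ _ _
  · simp

lemma form_evec_gvec : form u (Hyp r) (evec u r j) (gvec u r k q) = 0 := by
  rw [gvec]
  split_ifs
  · exact form_single _ _ _ _
  · simp

lemma form_gvec_evec : form u (Hyp r) (gvec u r k q) (evec u r j) = 0 := by
  rw [gvec]
  split_ifs
  · exact form_single _ _ _ _
  · simp

lemma form_hvec_gvec : form u (Hyp r) (hvec u r j p) (gvec u r k q) = 0 := by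
  rw [gvec, hvec]
  split_ifs
  · exact form_single _ _ _ _
  all_goals simp

lemma form_gvec_hvec : form u (Hyp r) (gvec u r k q) (hvec u r j p) = 0 := by
  rw [gvec, hvec]
  split_ifs
  · exact form_single _ _ _ _
  all_goals simp

lemma form_gvec_gvec : form u (Hyp r) (gvec u r j p) (gvec u r k q) = 0 := by
  rw [gvec, gvec]
  split_ifs
  · exact form_single _ _ _ _
  all_goals simp

end Vectors

/-! ### Products of the vectors attached to the vertices -/

section Rows

variable (u r s : Fin 2 → ℕ) (a x : Fin 6) (j k : Fin 2) (p q b : ℕ)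

/-- The vectors corresponding to the vertices on the linear parts of the glued quivers. -/
def vvec (j : Fin 2) (q : ℕ) : GramIndex u (Hyp r) → ℤ :=
  if q ≤ s j ∨ (q - s j) % 2 = 0 then hvec u r j q - fvec u r j ((q - s j) / 2)
  else hvec u r j (u j) - hvec u r j q + evec u r j + gvec u r j ((q - s j) / 2)

/-- The vectors corresponding to the other vertices of the glued quivers. -/
def wvec (j : Fin 2) (p : ℕ) : GramIndex u (Hyp r) → ℤ :=
  if p % 2 = 0 then hvec u r j (s j + p) - hvec u r j (s j + p + 1)
  else hvec u r j (s j + p + 1) - hvec u r j (s j + p)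

lemma vvec_eq : vvec u r s j q = if q ≤ s j ∨ (q - s j) % 2 = 0
    then hvec u r j q - fvec u r j ((q - s j) / 2)
    else hvec u r j (u j) - hvec u r j q + evec u r j + gvec u r j ((q - s j) / 2) := rfl

lemma wvec_eq : wvec u r s j p = if p % 2 = 0 then hvec u r j (s j + p) - hvec u r j (s j + p + 1)
    else hvec u r j (s j + p + 1) - hvec u r j (s j + p) := rfl

/-- For odd `q - s j > 0` the contributions of `h_u` and `e` cancel, both being supported at `b =
u`. What remains is the product of `h_q`, with a sign alternating along the triangles. -/
lemma form_vvec_hvec (hq : q ≤ u j) : form u (Hyp r) (vvec u r s j q) (hvec u r k b) =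
    if j = k ∧ q ≤ b ∧ b ≤ u k then (if q ≤ s j ∨ (q - s j) % 2 = 0 then 1 else -1) else 0 := by
  rw [vvec]
  by_cases hj : j = k
  · subst hj
    split_ifs <;>
      simp only [map_sub, map_add, LinearMap.sub_apply, LinearMap.add_apply, form_hvec_hvec,
        form_evec_hvec, form_fvec_hvec, form_gvec_hvec, true_and] <;> split_ifs <;> omega
  · rw [if_neg (c := j = k ∧ _) fun h => hj h.1]
    split_ifs <;>
      simp [map_sub, map_add, LinearMap.sub_apply, LinearMap.add_apply, form_hvec_hvec,
        form_evec_hvec, form_fvec_hvec, form_gvec_hvec, hj]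

lemma form_vvec_evec (hq : q ≤ u j) : form u (Hyp r) (vvec u r s j q) (evec u r k) =
    if j = k then 1 else 0 := by
  rw [vvec]
  by_cases hj : j = k
  · subst hj
    split_ifs <;>
      simp only [map_sub, map_add, LinearMap.sub_apply, LinearMap.add_apply, form_hvec_evec,
        form_evec_evec, form_fvec_evec, form_gvec_evec, true_and] <;> split_ifs <;> omega
  · rw [if_neg hj]
    split_ifs <;>
      simp [map_sub, map_add, LinearMap.sub_apply, LinearMap.add_apply, form_hvec_evec,
        form_evec_evec, form_fvec_evec, form_gvec_evec, hj]

lemma form_vvec_fvec : form u (Hyp r) (vvec u r s j q) (fvec u r k b) =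
    if j = k ∧ ¬ (q ≤ s j ∨ (q - s j) % 2 = 0) ∧ (q - s j) / 2 < b ∧ (q - s j) / 2 < r j
    then -2 else 0 := by
  rw [vvec]
  split_ifs with h1 h2 h2 <;>
    simp only [map_sub, map_add, LinearMap.sub_apply, LinearMap.add_apply, form_hvec_fvec,
      form_evec_fvec, form_fvec_fvec, form_gvec_fvec]
  · tauto
  · rfl
  · obtain ⟨rfl, h2⟩ := h2
    rw [if_pos ⟨rfl, h2.2⟩]; rfl
  · rw [if_neg fun h => h2 ⟨h.1.symm, h1, h.2⟩]; rfl

lemma form_vvec_gvec : form u (Hyp r) (vvec u r s j q) (gvec u r k b) =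
    if j = k ∧ (q ≤ s j ∨ (q - s j) % 2 = 0) ∧ b < (q - s j) / 2 ∧ b < r j
    then -2 else 0 := by
  rw [vvec]
  split_ifs with h1 h2 h2 <;>
    simp only [map_sub, map_add, LinearMap.sub_apply, LinearMap.add_apply, form_hvec_gvec,
      form_evec_gvec, form_fvec_gvec, form_gvec_gvec]
  · obtain ⟨rfl, h2⟩ := h2
    rw [if_pos ⟨rfl, h2.2⟩]; rfl
  · rw [if_neg fun h => h2 ⟨h.1, h1, by obtain ⟨rfl, h⟩ := h; exact h⟩]; rfl
  · tauto
  · rfl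

/-- The inequality gives `u j ≠ 0`, so the summand `h_u` of the odd vectors does not meet the
central cycle. -/
lemma form_vvec_ctr (hsu : s j < u j) : form u (Hyp r) (vvec u r s j q) (ctr u r x) =
    if (x : ℕ) = 3 * j ∧ q = 0 then 1 else 0 := by
  rw [vvec]
  split_ifs <;>
    simp only [map_sub, map_add, LinearMap.sub_apply, LinearMap.add_apply, form_hvec_ctr,
      form_evec_ctr, form_fvec_ctr, form_gvec_ctr] <;> split_ifs <;> omega

lemma form_ctr_vvec (hq : q ≤ u j) : form u (Hyp r) (ctr u r a) (vvec u r s j q) =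
    if (a : ℕ) = 3 * j + 1 then 1 else 0 := by
  rw [vvec]
  split_ifs <;>
    simp only [map_sub, map_add, form_ctr_hvec, form_ctr_evec, form_ctr_fvec, form_ctr_gvec] <;>
    split_ifs <;> omega

lemma form_ctr_wvec (hp : s j + p + 1 ≤ u j) :
    form u (Hyp r) (ctr u r a) (wvec u r s j p) = 0 := by
  rw [wvec]
  split_ifs <;> simp only [map_sub, form_ctr_hvec] <;> split_ifs <;> omega

lemma form_wvec_ctr : form u (Hyp r) (wvec u r s j p) (ctr u r x) =
    if (x : ℕ) = 3 * j ∧ s j + p = 0 then 1 else 0 := by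
  have h : s j + p + 1 ≠ 0 := by omega
  rw [wvec]
  split_ifs <;>
    simp only [map_sub, LinearMap.sub_apply, form_hvec_ctr, h, and_false, if_false] <;>
    split_ifs <;> omega

/-- For indices of equal parity the skew planes do not contribute. For opposite parity the
alternating sign gives `2` instead of `0` for an even first index after the second, and `-1` instead
of `1` for an odd first index before the second. The planes correct each by `∓2`. -/
lemma form_vvec_vvec (hu : u j = s j + 2 * r j + 1) (hp : p ≤ u j) (hq : q ≤ u k) :
    form u (Hyp r) (vvec u r s j p) (vvec u r s k q) = if j = k ∧ p ≤ q then 1 else 0 := by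
  rw [vvec_eq u r s k q]
  by_cases hj : j = k
  · subst hj
    split_ifs <;>
      simp only [map_sub, map_add, form_vvec_hvec u r s j j p _ hp,
        form_vvec_evec u r s j j p hp, form_vvec_fvec, form_vvec_gvec, true_and] <;>
      split_ifs <;> omega
  · rw [if_neg (c := j = k ∧ _) fun h => hj h.1]
    split_ifs <;>
      simp [form_vvec_hvec u r s j k p _ hp, form_vvec_evec u r s j k p hp, form_vvec_fvec,
        form_vvec_gvec, hj]

/-- A difference of consecutive `h` isolates one index `q`. The sign `(-1)^p` in `wvec` compensates
the sign of `vvec` there. -/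
lemma form_vvec_wvec (hq : q ≤ u j) (hp : s k + p + 1 ≤ u k) :
    form u (Hyp r) (vvec u r s j q) (wvec u r s k p) =
      if j = k ∧ q = s j + p + 1 then 1 else 0 := by
  rw [wvec]
  by_cases hj : j = k
  · subst hj
    split_ifs <;>
      simp only [map_sub, form_vvec_hvec u r s j j q _ hq, true_and] <;>
      split_ifs <;> omega
  · rw [if_neg (c := j = k ∧ _) fun h => hj h.1]
    split_ifs <;> simp [form_vvec_hvec u r s j k q _ hq, hj]

/-- Consecutive rows of the upper triangular matrix of ones differ in a single entry. -/
lemma form_wvec_hvec (hb : b ≤ u k) : form u (Hyp r) (wvec u r s j p) (hvec u r k b) =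
    if j = k ∧ b = s j + p then (if p % 2 = 0 then 1 else -1) else 0 := by
  rw [wvec]
  by_cases hj : j = k
  · subst hj
    split_ifs <;> simp only [map_sub, LinearMap.sub_apply, form_hvec_hvec, true_and] <;>
      split_ifs <;> omega
  · rw [if_neg (c := j = k ∧ _) fun h => hj h.1]
    split_ifs <;> simp [form_hvec_hvec, hj]

lemma form_wvec_vvec (hq : q ≤ u k) (hp : s j + p + 1 ≤ u j) :
    form u (Hyp r) (wvec u r s j p) (vvec u r s k q) =
      if j = k ∧ q = s j + p then 1 else 0 := by
  have hE : form u (Hyp r) (wvec u r s j p) (evec u r k) = 0 := by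
    rw [wvec]
    split_ifs <;> simp only [map_sub, LinearMap.sub_apply, form_hvec_evec] <;>
      split_ifs <;> omega
  have hF : ∀ i, form u (Hyp r) (wvec u r s j p) (fvec u r k i) = 0 := fun i => by
    rw [wvec]; split_ifs <;> simp [form_hvec_fvec]
  have hG : ∀ i, form u (Hyp r) (wvec u r s j p) (gvec u r k i) = 0 := fun i => by
    rw [wvec]; split_ifs <;> simp [form_hvec_gvec]
  rw [vvec]
  by_cases hj : j = k
  · subst hj
    split_ifs <;>
      simp only [map_sub, map_add, form_wvec_hvec u r s j j p q hq,
        form_wvec_hvec u r s j j p (u j) le_rfl, hE, hF, hG, true_and] <;>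
      split_ifs <;> omega
  · rw [if_neg (c := j = k ∧ _) fun h => hj h.1]
    split_ifs <;>
      simp [form_wvec_hvec u r s j k p q hq, form_wvec_hvec u r s j k p (u k) le_rfl, hE, hF, hG, hj]

lemma form_wvec_wvec (hq : s k + q + 1 ≤ u k) :
    form u (Hyp r) (wvec u r s j p) (wvec u r s k q) =
      if j = k ∧ (p = q ∨ p = q + 1) then 1 else 0 := by
  rw [wvec_eq u r s k q]
  by_cases hj : j = k
  · subst hj
    split_ifs <;>
      simp only [map_sub, form_wvec_hvec u r s j j p (s j + q) (by omega),
        form_wvec_hvec u r s j j p (s j + q + 1) hq, true_and] <;>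
      split_ifs <;> omega
  · rw [if_neg (c := j = k ∧ _) fun h => hj h.1]
    split_ifs <;>
      simp [form_wvec_hvec u r s j k p (s k + q) (by omega),
        form_wvec_hvec u r s j k p (s k + q + 1) hq, hj]

end Rows

/-! ### The vertex vectors form a basis with the Cartan products -/

section Congruence

variable {s t u r : Fin 2 → ℕ}

/-- The basis vectors corresponding to the vertices of `twoSpike s t`. -/
def vec (u r : Fin 2 → ℕ) : Vert s t → GramIndex u (Hyp r) → ℤ
  | Sum.inl a => ctr u r a
  | Sum.inr ⟨j, Sum.inl q⟩ => vvec u r s j q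
  | Sum.inr ⟨j, Sum.inr p⟩ => wvec u r s j p

open Classical in
lemma form_vec_vec (hu : ∀ j, s j + t j = u j) (ht : ∀ j, t j = 2 * r j + 1) (x y : Vert s t) :
    form u (Hyp r) (vec u r x) (vec u r y) = if Reach x y then 1 else 0 := by
  have hv : ∀ j (q : Fin (s j + t j + 1)), (q : ℕ) ≤ u j := fun j q => by
    have := hu j; omega
  have hw : ∀ j (p : Fin (t j)), s j + p + 1 ≤ u j := fun j p => by
    have := hu j; omega
  rcases x with a | ⟨j, q | p⟩ <;> rcases y with b | ⟨k, q' | p'⟩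
  · exact (form_ctr_ctr _ _ _ _).trans (if_congr Iff.rfl rfl rfl)
  · exact (form_ctr_vvec _ _ _ _ _ _ (hv _ _)).trans (if_congr Iff.rfl rfl rfl)
  · exact (form_ctr_wvec _ _ _ _ _ _ (hw _ _)).trans (if_neg not_false).symm
  · exact (form_vvec_ctr _ _ _ _ _ _ (by have := hu j; have := ht j; omega)).trans
      (if_congr Iff.rfl rfl rfl)
  · exact (form_vvec_vvec _ _ _ _ _ _ _ (by have := hu j; have := ht j; omega) (hv _ _)
      (hv _ _)).trans (if_congr Iff.rfl rfl rfl)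
  · exact (form_vvec_wvec _ _ _ _ _ _ _ (hv _ _) (hw _ _)).trans (if_congr Iff.rfl rfl rfl)
  · exact (form_wvec_ctr _ _ _ _ _ _).trans (if_congr Iff.rfl rfl rfl)
  · exact (form_wvec_vvec _ _ _ _ _ _ _ (hv _ _) (hw _ _)).trans (if_congr Iff.rfl rfl rfl)
  · exact (form_wvec_wvec _ _ _ _ _ _ _ (hw _ _)).trans (if_congr Iff.rfl rfl rfl)

lemma vvec_mem_span (hu : ∀ j, s j + t j = u j) (j : Fin 2) {q : ℕ} (hq : q ≤ u j) :
    vvec u r s j q ∈ Submodule.span ℤ (Set.range (vec (s := s) (t := t) u r)) :=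
  Submodule.subset_span ⟨Sum.inr ⟨j, Sum.inl ⟨q, by rw [hu]; omega⟩⟩, rfl⟩

/-- Up to `s j` the vectors `h_q` are vertex vectors themselves; beyond, each `wvec` is, up to sign,
the difference of two consecutive ones. -/
lemma hvec_mem_span (hu : ∀ j, s j + t j = u j) (j : Fin 2) (q : ℕ) :
    hvec u r j q ∈ Submodule.span ℤ (Set.range (vec (s := s) (t := t) u r)) := by
  have hs : ∀ q ≤ s j, hvec u r j q ∈
      Submodule.span ℤ (Set.range (vec (s := s) (t := t) u r)) := fun q hq => by
    have h := vvec_mem_span (r := r) hu j (q := q) (by have := hu j; omega)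
    rwa [vvec_eq, if_pos (Or.inl hq), Nat.sub_eq_zero_of_le hq, Nat.zero_div,
      show fvec u r j 0 = 0 by simp [fvec], sub_zero] at h
  have ht : ∀ p, hvec u r j (s j + p) ∈
      Submodule.span ℤ (Set.range (vec (s := s) (t := t) u r)) := fun p => by
    induction p with
    | zero => exact hs _ le_rfl
    | succ p ih =>
      by_cases hp : p < t j
      · have h : wvec u r s j p ∈ Submodule.span ℤ (Set.range (vec (s := s) (t := t) u r)) :=
          Submodule.subset_span ⟨Sum.inr ⟨j, Sum.inr ⟨p, hp⟩⟩, rfl⟩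
        rw [wvec_eq] at h
        split_ifs at h
        · simpa [add_assoc] using sub_mem ih h
        · simpa [add_assoc] using add_mem h ih
      -- Past the end of the linear part `hvec` has the default value zero.
      · rw [hvec, dif_neg (by have := hu j; omega)]
        exact zero_mem _
  rcases le_total q (s j) with h | h
  · exact hs q h
  · rw [← Nat.add_sub_cancel' h]
    exact ht _

/-- Once the `h_q` are available, `e` is the last linear vertex, the even vertices give the partial
sums of the `f_i`, hence the `f_i` by differences, and the odd ones give the `g_i`. -/
lemma single_mem_span (hu : ∀ j, s j + t j = u j) (ht : ∀ j, t j = 2 * r j + 1)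
    (x : GramIndex u (Hyp r)) :
    (Pi.single x 1 : GramIndex u (Hyp r) → ℤ) ∈
      Submodule.span ℤ (Set.range (vec (s := s) (t := t) u r)) := by
  have hE : ∀ j, evec u r j ∈ Submodule.span ℤ (Set.range (vec (s := s) (t := t) u r)) :=
    fun j => by
      have h := vvec_mem_span (r := r) hu j le_rfl
      have h1 := hu j
      have h2 := ht j
      -- At `q = u j` the offset `t j` is odd, the two copies of `h_u` cancel, and the index `r j`
      -- of `gvec` is out of range, so only `e` is left.
      rw [vvec_eq, if_neg (by omega), gvec, dif_neg (by omega)] at h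
      simpa using h
  have hF : ∀ j, ∀ k ≤ r j, fvec u r j k ∈
      Submodule.span ℤ (Set.range (vec (s := s) (t := t) u r)) := fun j k hk => by
    have h1 := hu j
    have h2 := ht j
    have h := vvec_mem_span (r := r) hu j (q := s j + 2 * k) (by omega)
    rw [vvec_eq, if_pos (by omega), show (s j + 2 * k - s j) / 2 = k by omega] at h
    simpa using sub_mem (hvec_mem_span hu j (s j + 2 * k)) h
  rcases x with a | ⟨j, q | _⟩ | ⟨j, i⟩ | ⟨j, i⟩
  · exact Submodule.subset_span ⟨Sum.inl a, rfl⟩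
  · have h := hvec_mem_span (r := r) hu j q
    rwa [hvec, dif_pos q.2] at h
  · exact hE j
  · have h := sub_mem (hF j (i + 1) i.2) (hF j i i.2.le)
    rw [fvec, fvec, ← Finset.sum_sub_distrib, Finset.sum_eq_single i] at h
    · simpa using h
    · intro k _ hk
      have : (k : ℕ) ≠ i := fun h => hk (Fin.ext h)
      split_ifs
      · exact sub_self _
      · omega
      · omega
      · exact sub_self _
    · simp
  · have h1 := hu j
    have h2 := ht j
    have h3 := i.2
    have h := vvec_mem_span (r := r) hu j (q := s j + 2 * i + 1) (by omega)
    rw [vvec_eq, if_neg (by omega), show (s j + 2 * i + 1 - s j) / 2 = i by omega, gvec,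
      dif_pos i.2] at h
    simpa using sub_mem h (add_mem (sub_mem (hvec_mem_span hu j (u j))
      (hvec_mem_span hu j (s j + 2 * i + 1))) (hE j))

lemma card_vert (hu : ∀ j, s j + t j = u j) (ht : ∀ j, t j = 2 * r j + 1) :
    Fintype.card (Vert s t) = Fintype.card (GramIndex u (Hyp r)) := by
  have h1 := hu 0
  have h2 := hu 1
  have h3 := ht 0
  have h4 := ht 1
  simp only [Fintype.card_sum, Fintype.card_sigma, Fintype.card_fin, Fin.sum_univ_two,
    Fintype.card_unit]
  omega

end Congruence

end TwoSpike
end BoundQuiver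

/-! ### Integral equivalence of forms -/

section IntEquivalentForms

variable {V W U : Type*} [Fintype V] [DecidableEq V] [Fintype W] [DecidableEq W] [Fintype U]
  [DecidableEq U]

/-- A pair of mutually inverse matrices between the two index sets replaces the bijection together
with an invertible matrix. In this shape symmetry and transitivity are matrix algebra. -/
lemma intEquivalentForms_iff {C : Matrix V V ℤ} {C' : Matrix W W ℤ} :
    IntEquivalentForms C C' ↔ ∃ (Q : Matrix W V ℤ) (Q' : Matrix V W ℤ),
      Q * Q' = 1 ∧ Q' * Q = 1 ∧ Q * C * Qᵀ = C' := by
  constructor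
  · rintro ⟨e, P, h⟩
    refine ⟨(P : Matrix V V ℤ).submatrix e id, (↑P⁻¹ : Matrix V V ℤ).submatrix id e, ?_, ?_, ?_⟩
    · rw [← submatrix_mul _ _ _ _ _ Function.bijective_id, ← Units.val_mul, mul_inv_cancel,
        Units.val_one, submatrix_one_equiv]
    · rw [submatrix_mul_equiv, ← Units.val_mul, inv_mul_cancel, Units.val_one, submatrix_id_id]
    · rw [transpose_submatrix, ← submatrix_id_id C,
        ← submatrix_mul _ _ _ _ _ Function.bijective_id,
        ← submatrix_mul _ _ _ _ _ Function.bijective_id, h]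
      ext; simp
  · rintro ⟨Q, Q', h1, h2, h3⟩
    let e : W ≃ V := Fintype.equivOfCardEq (Matrix.square_of_invertible Q Q' h1 h2)
    refine ⟨e, ⟨Q.submatrix e.symm id, Q'.submatrix id e.symm, ?_, ?_⟩, ?_⟩
    · rw [← submatrix_mul _ _ _ _ _ Function.bijective_id, h1, submatrix_one_equiv]
    · rw [submatrix_mul_equiv, h2, submatrix_id_id]
    · change Q.submatrix e.symm id * C * (Q.submatrix e.symm id)ᵀ = _
      rw [transpose_submatrix, ← submatrix_id_id C,
        ← submatrix_mul _ _ _ _ _ Function.bijective_id,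
        ← submatrix_mul _ _ _ _ _ Function.bijective_id, h3]
      rfl

lemma IntEquivalentForms.symm {C : Matrix V V ℤ} {C' : Matrix W W ℤ}
    (h : IntEquivalentForms C C') : IntEquivalentForms C' C := by
  obtain ⟨Q, Q', h1, h2, rfl⟩ := intEquivalentForms_iff.1 h
  refine intEquivalentForms_iff.2 ⟨Q', Q, h2, h1, ?_⟩
  rw [Matrix.mul_assoc, Matrix.mul_assoc, ← transpose_mul, h2, transpose_one, Matrix.mul_one,
    ← Matrix.mul_assoc, h2, Matrix.one_mul]

lemma IntEquivalentForms.trans {C : Matrix V V ℤ} {C' : Matrix W W ℤ} {C'' : Matrix U U ℤ}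
    (h : IntEquivalentForms C C') (h' : IntEquivalentForms C' C'') :
    IntEquivalentForms C C'' := by
  obtain ⟨Q, Q', h1, h2, rfl⟩ := intEquivalentForms_iff.1 h
  obtain ⟨R, R', h3, h4, rfl⟩ := intEquivalentForms_iff.1 h'
  refine intEquivalentForms_iff.2 ⟨R * Q, Q' * R', ?_, ?_, ?_⟩
  · rw [Matrix.mul_assoc, ← Matrix.mul_assoc Q, h1, Matrix.one_mul, h3]
  · rw [Matrix.mul_assoc, ← Matrix.mul_assoc R', h4, Matrix.one_mul, h2]
  · simp only [transpose_mul, Matrix.mul_assoc]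

lemma intEquivalentForms_submatrix {V W : Type*} [Fintype V] [DecidableEq V]
    (C : Matrix V V ℤ) (e : W ≃ V) :
    IntEquivalentForms C (C.submatrix e e) :=
  ⟨e, 1, by simp⟩

/-- The Gram matrices of a bilinear form with respect to two bases are equivalent. -/
lemma intEquivalentForms_of_span {G : Matrix W W ℤ} {C : Matrix V V ℤ} (φ : V → W → ℤ)
    (hcard : Fintype.card V = Fintype.card W)
    (hφ : ∀ x y, Matrix.toBilin' G (φ x) (φ y) = C x y)
    (hspan : ∀ w, Pi.single w 1 ∈ Submodule.span ℤ (Set.range φ)) :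
    IntEquivalentForms G C := by
  choose P hP using fun w => (Submodule.mem_span_range_iff_exists_fun ℤ).1 (hspan w)
  -- The coefficients expressing the standard basis through `φ` form a one-sided inverse. It is
  -- two-sided because the index sets have equal size.
  have h : (Matrix.of P) * (Matrix.of φ) = 1 := by
    ext w w'
    have := congrFun (hP w) w'
    rw [Matrix.one_eq_pi_single, ← this]
    simp [Matrix.mul_apply]
  refine intEquivalentForms_iff.2 ⟨Matrix.of φ, Matrix.of P,
    (Matrix.mul_eq_one_comm_of_equiv (Fintype.equivOfCardEq hcard).symm).1 h, h, ?_⟩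
  ext x y
  rw [← hφ, Matrix.toBilin'_apply', Matrix.dotProduct_mulVec]
  rfl

end IntEquivalentForms

/-! ### Pooling the skew planes of the two tails -/

namespace BoundQuiver
namespace TwoSpike

/-- The planes are orthogonal to everything else and all alike, so only their number counts, not the
tail that they come from. -/
lemma intEquivalentForms_gram (u : Fin 2 → ℕ) {R R' : Type} [Fintype R] [DecidableEq R]
    [Fintype R'] [DecidableEq R'] (e : R' ≃ R) :
    IntEquivalentForms (gram u R) (gram u R') := by
  convert intEquivalentForms_submatrix (gram u R)
    ((Equiv.refl (Fin 6)).sumCongr ((Equiv.refl (Σ j : Fin 2, Fin (u j + 1) ⊕ Unit)).sumCongr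
      (e.sumCongr e))) using 1
  ext x y
  rcases x with a | ⟨j, q | _⟩ | i | i <;> rcases y with b | ⟨k, q' | _⟩ | i' | i' <;>
    simp [gram]

lemma intEquivalentForms_cartan_gram (K : Type*) [Field K] {s t u r : Fin 2 → ℕ}
    (hu : ∀ j, s j + t j = u j) (ht : ∀ j, t j = 2 * r j + 1) :
    IntEquivalentForms ((twoSpike s t).cartan K) (gram u (Hyp r)) := by
  refine (intEquivalentForms_submatrix _ (equiv s t)).trans
    (intEquivalentForms_of_span (vec u r) (card_vert hu ht) (fun x y => ?_)
      (single_mem_span hu ht)).symm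
  rw [submatrix_apply, cartan_equiv]
  exact form_vec_vec hu ht x y

/-- The class of the Cartan matrix of `twoSpike s t`, for odd `t j`, only depends on the sums
`s j + t j` and on `t 0 + t 1`. -/
lemma intEquivalentForms_cartan (K : Type*) [Field K] {s t s' t' r r' : Fin 2 → ℕ}
    (ht : ∀ j, t j = 2 * r j + 1) (ht' : ∀ j, t' j = 2 * r' j + 1)
    (hst : ∀ j, s j + t j = s' j + t' j) (hr : r 0 + r 1 = r' 0 + r' 1) :
    IntEquivalentForms ((twoSpike s t).cartan K) ((twoSpike s' t').cartan K) := by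
  refine (intEquivalentForms_cartan_gram K hst ht).trans
    ((intEquivalentForms_gram _ (Fintype.equivOfCardEq ?_)).trans
      (intEquivalentForms_cartan_gram K (fun _ => rfl) ht').symm)
  simp [Fin.sum_univ_two, hr]

end TwoSpike

open TwoSpike

lemma typeIV_eq_twoSpike (s₀ t₀ s₁ t₁ : ℕ) :
    typeIV [(3, s₀, t₀), (3, s₁, t₁)] = twoSpike ![s₀, s₁] ![t₀, t₁] := by
  have hi : (fun j : Fin 2 => ((([(3, s₀, t₀), (3, s₁, t₁)] : List (ℕ × ℕ × ℕ)).take j).map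
      fun x => x.1).sum) = fun j : Fin 2 => 3 * (j : ℕ) := by
    funext j; fin_cases j <;> rfl
  have hs : (fun j : Fin 2 => (([(3, s₀, t₀), (3, s₁, t₁)] : List (ℕ × ℕ × ℕ)).get j).2.1) =
      ![s₀, s₁] := by
    funext j; fin_cases j <;> rfl
  have ht : (fun j : Fin 2 => (([(3, s₀, t₀), (3, s₁, t₁)] : List (ℕ × ℕ × ℕ)).get j).2.2) =
      ![t₀, t₁] := by
    funext j; fin_cases j <;> rfl
  rw [← hs, ← ht]
  exact congrArg (fun i => glue (skeletonIV 6 2 i) (fun j => Sum.inr j) _ _) hi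

end BoundQuiver

/-! ### The family of standard forms -/

theorem corollary2p12 (K : Type*) [Field K] [IsAlgClosed K] (m : ℕ) (hm : 1 ≤ m) :
    ∃ F : Fin (m + 1) → StandardForm,
      (∀ i j, i ≠ j → ¬ (F i).Same (F j)) ∧
      (∀ i, (F i).quiver.IsMutationEquivalentToD (6 * m + 13)) ∧
      (∀ i, Module.Finite K ((F i).quiver.Alg K)) ∧
      ∀ i j, IntEquivalentForms ((F i).quiver.cartan K) ((F j).quiver.cartan K) := by
  have hQ : ∀ i : Fin (m + 1), (StandardForm.d₃ 0 [(2 * i, 2 * m + 1 - 2 * i),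
      (2 * m + 1 - 2 * i, 2 * i + 1)] (List.cons_ne_nil _ _)).quiver =
      BoundQuiver.twoSpike ![2 * i, 2 * m + 1 - 2 * i] ![2 * m + 1 - 2 * i, 2 * i + 1] :=
    fun i => BoundQuiver.typeIV_eq_twoSpike _ _ _ _
  refine ⟨fun i => StandardForm.d₃ 0 [(2 * i, 2 * m + 1 - 2 * i),
      (2 * m + 1 - 2 * i, 2 * i + 1)] (List.cons_ne_nil _ _), ?_, ?_, ?_, ?_⟩
  · rintro i j hij ⟨-, h⟩
    -- A rotation preserves membership. The first pair for `i` has even first entry, so it can only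
    -- be the first pair for `j`.
    have h := h.mem_iff (a := (2 * (i : ℕ), 2 * m + 1 - 2 * (i : ℕ)))
    simp only [List.mem_cons, Prod.mk.injEq, List.not_mem_nil, or_false, true_or,
      true_iff] at h
    omega
  · intro i
    rw [hQ]
    refine BoundQuiver.TwoSpike.isMutationEquivalentToD _ _ ?_
    simp only [Matrix.cons_val_zero, Matrix.cons_val_one]
    omega
  · intro i
    rw [hQ]
    exact BoundQuiver.TwoSpike.finite_alg K _ _
  · intro i j
    rw [hQ, hQ]
    -- Here `2m+1-2i = 2(m-i)+1`, so the tails contribute `m - i` and `i` skew planes, `m` in all.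
    refine BoundQuiver.TwoSpike.intEquivalentForms_cartan K
      (r := ![m - i, i]) (r' := ![m - j, j]) ?_ ?_ ?_ ?_
    · intro k
      fin_cases k <;> simp <;> omega
    · intro k
      fin_cases k <;> simp <;> omega
    · intro k
      fin_cases k <;> simp <;> omega
    · simp only [Matrix.cons_val_zero, Matrix.cons_val_one]
      omega
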